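/- Let $\Omega\subset\mathbb R^2$ be a nonempty bounded convex polygonal open set and let $\rho>0$. A triangulation of $\Omega$ is a finite collection of pairwise disjoint open (nondegenerate) triangles whose closures have union $\overline\Omega$, such that no vertex of a triangle lies in the relative interior of an edge of another triangle. Let $(\mathcal T_n)_{n\in\mathbb N}$ be triangulations of $\Omega$ and $(h_n)_{n\in\mathbb N}$ a decreasing sequence of reals with $h_n\to0$ such that, for all $n$ and all $T\in\mathcal T_n$, $$\operatorname{diam}T\le h_n\operatorname{diam}\Omega,\qquad \operatorname{diam}B_T\ge\rho\operatorname{diam}T,$$ where $B_T$ is the largest ball contained in $T$ (nondegeneracy). Write $P_k$ for the polynomials in two variables of degree at most $k$. For a triangle $T$ with vertices $z_1,z_2,z_3$, let the local interpolant $I_Tu$ be either * (quadratic Lagrange) the polynomial $\sum_{i=1}^6u(z_i)\psi_i\in P_2$, where $z_4,z_5,z_6$ are the midpoints of the edges and $(\psi_i)$ is the basis of $P_2$ dual to the evaluations at $z_1,\dots,z_6$; or * (cubic Hermite) the polynomial $\sum_{i=1}^4u(z_i)\psi_i+\sum_{1\le i\ne j\le3}\big(\nabla u(z_i)\cdot(z_j-z_i)\big)\psi_{i\to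 j}\in P_3$, where $z_4$ is the barycenter and $(\psi_i,\psi_{i\to j})$ is the basis of $P_3$ dual to the nodal variables $p\mapsto p(z_i)$ $(1\le i\le4)$ and $p\mapsto\nabla p(z_i)\cdot(z_j-z_i)$ $(1\le i\neq j\le 3)$. Let $I_{\mathcal T}u$ be the function which coincides with $I_Tu$ on each triangle $T\in\mathcal T$. For $f\in L^1_{\mathrm{loc}}(\Omega)$ let $$|D^2f|(\Omega)=\sup\Big\{\int_\Omega f\sum_{i,j}\frac{\partial^2\varphi_{ij}}{\partial x_i\partial x_j}\,dx:\ \varphi\in C_c^\infty(\Omega,\mathbb R^{2\times2}_{\mathrm{sym}}),\ |\varphi(x)|_F\le1\ \text{for all } x\in\Omega\Big\}$$ be the total variation of the distributional Hessian (thus, for $f=u-I_{\mathcal T}u$, it includes the jumps of the normal derivative across edges). Then there is a constant $C\ge0$, depending only on $\rho$ and $\Omega$, such that for both choices of the finite element, for every $u\in C^3(\overline\Omega)$ and every $n\in\mathbb N$, with $\mathcal T=\mathcal T_n$ and $h=h_n$, $$\|u-I_{\mathcal T}u\|_{W^{1,1}(\Omega)}\le C\,|\Omega|\,h^2\,\|\nabla^3u\|_{L^\infty(\Omega)},\qquad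 |D^2u-D^2I_{\mathcal T}u|(\Omega)\le C\,|\Omega|\,h\,\|\nabla^3u\|_{L^\infty(\Omega)}.$$ -/

import Mathlib

open MeasureTheory Filter Topology
open scoped ENNReal NNReal

noncomputable section

namespace PlateFEM

/-- The Euclidean plane `ℝ²`. -/
abbrev Plane : Type := EuclideanSpace ℝ (Fin 2)

/-- Nondegenerate triangles of the plane, given by their three vertices `t.points`. The open triangle
is `t.interior`, the closed triangle is `t.closedInterior`. -/
abbrev Tri : Type := Affine.Triangle ℝ Plane

/-- Nonempty (bounded) convex polygonal open sets of the plane: the closure is the convex hull of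
finitely many points. -/
structure IsConvexPolygonalDomain (Ω : Set Plane) : Prop where
  isOpen : IsOpen Ω
  nonempty : Ω.Nonempty
  convex : Convex ℝ Ω
  polygonal : ∃ V : Finset Plane, closure Ω = convexHull ℝ (V : Set Plane)

/-! ### Sobolev norm and total variation of the Hessian -/

/-- The classical partial derivative `∂f/∂xᵢ`. -/
def partialDeriv (i : Fin 2) (f : Plane → ℝ) (x : Plane) : ℝ :=
  fderiv ℝ f x (EuclideanSpace.single i 1)

/-- `φ ∈ C_c^∞(Ω)`. -/
structure IsTestFunction (Ω : Set Plane) (φ : Plane → ℝ) : Prop where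
  smooth : ContDiff ℝ ((⊤ : ℕ∞) : WithTop ℕ∞) φ
  compact : HasCompactSupport φ
  support : tsupport φ ⊆ Ω

/-- `g` is the weak (distributional) gradient of `f` on the open set `Ω`. -/
structure IsWeakGradient (Ω : Set Plane) (f : Plane → ℝ) (g : Plane → Plane) : Prop where
  locInt : LocallyIntegrableOn f Ω
  locInt_grad : LocallyIntegrableOn g Ω
  integral_eq : ∀ φ : Plane → ℝ, IsTestFunction Ω φ → ∀ i : Fin 2,
    ∫ x in Ω, f x * partialDeriv i φ x = - ∫ x in Ω, g x i * φ x

/-- The norm `‖f‖_{L¹(Ω)} + ‖∇f‖_{L¹(Ω)}` of `W^{1,1}(Ω)`, with value `⊤` if `f` has no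
weak gradient that is a locally integrable function (the weak gradient is unique
up to null sets, so that the infimum is over equal values). -/
def normW11 (Ω : Set Plane) (f : Plane → ℝ) : ℝ≥0∞ :=
  ⨅ (g : Plane → Plane) (_ : IsWeakGradient Ω f g),
    (eLpNorm f 1 (volume.restrict Ω) + eLpNorm g 1 (volume.restrict Ω))

/-- Symmetric matrix fields `φ ∈ C_c^∞(Ω, S²)` with `|φ(x)|_F ≤ 1` on `Ω`. -/
structure IsTestTensor (Ω : Set Plane) (φ : Fin 2 → Fin 2 → Plane → ℝ) : Prop where
  test : ∀ i j, IsTestFunction Ω (φ i j)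
  symm : ∀ i j, φ i j = φ j i
  frobenius : ∀ x ∈ Ω, Real.sqrt (∑ i, ∑ j, φ i j x ^ 2) ≤ 1

/-- `div div φ = ∑ᵢⱼ ∂²φᵢⱼ/∂xᵢ∂xⱼ`. -/
def divDiv (φ : Fin 2 → Fin 2 → Plane → ℝ) (x : Plane) : ℝ :=
  ∑ i, ∑ j, partialDeriv i (partialDeriv j (φ i j)) x

/-- The total variation `|D²f|(Ω)` of the distributional Hessian of `f`, that is
`sup {∫_Ω f div div φ : φ ∈ C_c^∞(Ω, S²), |φ|_F ≤ 1}`; it accounts for the singular parts of `D²f`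
(such as the jumps of the normal derivative across lines). -/
def hessianVariation (Ω : Set Plane) (f : Plane → ℝ) : ℝ≥0∞ :=
  ⨆ (φ : Fin 2 → Fin 2 → Plane → ℝ) (_ : IsTestTensor Ω φ),
    ENNReal.ofReal (∫ x in Ω, f x * divDiv φ x)

/-- `‖∇³u‖_{L^∞(Ω)}`. -/
def thirdDerivNorm (Ω : Set Plane) (u : Plane → ℝ) : ℝ≥0∞ :=
  eLpNorm (iteratedFDeriv ℝ 3 u) ⊤ (volume.restrict Ω)

/-! ### Triangulations -/

/-- Triangulations of `Ω`: finitely many pairwise disjoint open triangles whose closures cover the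
closure of `Ω`, such that no vertex of a triangle lies in the relative interior of an edge of another
triangle. -/
structure IsTriangulation (Ω : Set Plane) (𝒯 : Finset Tri) : Prop where
  disjoint : ∀ s ∈ 𝒯, ∀ t ∈ 𝒯, s ≠ t → Disjoint s.interior t.interior
  cover : ⋃ t ∈ 𝒯, t.closedInterior = closure Ω
  conforming : ∀ s ∈ 𝒯, ∀ t ∈ 𝒯, s ≠ t → ∀ i j k : Fin 3, j ≠ k →
    s.points i ∉ openSegment ℝ (t.points j) (t.points k)

/-- The diameter of the largest ball contained in `T`. -/
def inscribedDiam (T : Set Plane) : ℝ :=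
  sSup {d : ℝ | ∃ (x : Plane) (r : ℝ), Metric.ball x r ⊆ T ∧ d = Metric.diam (Metric.ball x r)}

/-- A family of triangulations `𝒯 n` of `Ω` with mesh sizes `h n` decreasing to `0`
(relative to the diameter of `Ω`), nondegenerate with constant `ρ`. -/
structure IsNondegenerateFamily (Ω : Set Plane) (ρ : ℝ) (𝒯 : ℕ → Finset Tri) (h : ℕ → ℝ) :
    Prop where
  triangulation : ∀ n, IsTriangulation Ω (𝒯 n)
  antitone : Antitone h
  tendsto_zero : Tendsto h atTop (𝓝 0)
  diam_le : ∀ n, ∀ t ∈ 𝒯 n, Metric.diam t.interior ≤ h n * Metric.diam Ω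
  nondegenerate : ∀ n, ∀ t ∈ 𝒯 n, ρ * Metric.diam t.interior ≤ inscribedDiam t.interior

/-! ### Finite elements -/

/-- `p ∈ P_k`: polynomial functions of two variables of total degree at most `k`. -/
def IsPoly (k : ℕ) (p : Plane → ℝ) : Prop :=
  ∃ P : MvPolynomial (Fin 2) ℝ, P.totalDegree ≤ k ∧ ∀ x, p x = MvPolynomial.eval (fun i => x i) P

/-- `ψ` is the basis of `P_k` dual to the family `N` of nodal variables. (In the uses below, the number of
nodal variables is the dimension of `P_k`.) -/
def IsDualBasis {ι : Type} [DecidableEq ι] (k : ℕ) (N : ι → (Plane → ℝ) → ℝ)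
    (ψ : ι → Plane → ℝ) : Prop :=
  (∀ i, IsPoly k (ψ i)) ∧ ∀ i j, N i (ψ j) = if i = j then 1 else 0

/-- The shape functions: the basis of `P_k` dual to the nodal variables `N`. -/
def shape {ι : Type} [DecidableEq ι] (k : ℕ) (N : ι → (Plane → ℝ) → ℝ) : ι → Plane → ℝ :=
  Classical.epsilon (IsDualBasis k N)

/-- The local interpolant `u ↦ ∑ᵢ Nᵢ(u) ψᵢ` in `P_k` with nodal variables `N`. -/
def localInterp {ι : Type} [Fintype ι] [DecidableEq ι] (k : ℕ) (N : ι → (Plane → ℝ) → ℝ)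
    (u : Plane → ℝ) (x : Plane) : ℝ :=
  ∑ i, N i u * shape k N i x

/-- The six nodal variables of the quadratic Lagrange triangle: the values at the vertices and at the
midpoints of the edges (the edge `i` being opposite to the vertex `i`). -/
def lagrangeNodal (t : Tri) : Fin 3 ⊕ Fin 3 → (Plane → ℝ) → ℝ
  | Sum.inl i, u => u (t.points i)
  | Sum.inr i, u => u (midpoint ℝ (t.points (i + 1)) (t.points (i + 2)))

/-- The ten nodal variables of the cubic Hermite triangle: the values at the vertices and at the
barycenter, and the derivatives `∇u(zᵢ)·(zⱼ - zᵢ)`, `i ≠ j`, at the vertices. Here `u` is a `C¹`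
function on the closed triangle. -/
def hermiteNodal (t : Tri) :
    Fin 3 ⊕ Unit ⊕ {p : Fin 3 × Fin 3 // p.1 ≠ p.2} → (Plane → ℝ) → ℝ
  | Sum.inl i, u => u (t.points i)
  | Sum.inr (Sum.inl _), u => u (Finset.univ.centroid ℝ t.points)
  | Sum.inr (Sum.inr p), u =>
      fderivWithin ℝ u t.closedInterior (t.points p.1.1) (t.points p.1.2 - t.points p.1.1)

/-- The local `P₂` Lagrange interpolant on the triangle `t`. -/
def lagrangeLocal (t : Tri) (u : Plane → ℝ) : Plane → ℝ := localInterp 2 (lagrangeNodal t) u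

/-- The local `P₃` Hermite interpolant on the triangle `t`. -/
def hermiteLocal (t : Tri) (u : Plane → ℝ) : Plane → ℝ := localInterp 3 (hermiteNodal t) u

open Classical in
/-- The global interpolant, which coincides with the local one on each triangle of `𝒯`. (On an edge
shared by two triangles the two local interpolants used below agree.) -/
def globalInterp (loc : Tri → (Plane → ℝ) → Plane → ℝ) (𝒯 : Finset Tri) (u : Plane → ℝ)
    (x : Plane) : ℝ :=
  if hx : ∃ t ∈ 𝒯, x ∈ t.closedInterior then loc hx.choose u x else 0

/-- The `P₂` Lagrange interpolant on the triangulation `𝒯`. -/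
def lagrangeInterp (𝒯 : Finset Tri) (u : Plane → ℝ) : Plane → ℝ := globalInterp lagrangeLocal 𝒯 u

/-- The `P₃` Hermite interpolant on the triangulation `𝒯`. -/
def hermiteInterp (𝒯 : Finset Tri) (u : Plane → ℝ) : Plane → ℝ := globalInterp hermiteLocal 𝒯 u

end PlateFEM

end

noncomputable section

namespace PlateFEM

/-! Locally this is the Bramble–Hilbert argument done by hand. On a triangle of diameter d let q be
the quadratic Taylor polynomial of u at a vertex and M = ‖∇³u‖_∞. Then v = u - q and its first two
derivatives are bounded by M d³, M d², M d. Both elements reproduce P₂, so u - Iu = v - Σ Nᵢ(v) ψᵢ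
with |Nᵢ(v)| ≤ M d³. The ψᵢ are explicit polynomials in the barycentric coordinates, whose gradients
are at most 2/r if the triangle contains a ball of radius r. `C2Bound` records such bounds at an
inverse length G and is stable under sums and products. With G = 2/r it gives errors of order M d³,
M d³/r, M d³/r² for the derivatives of order 0, 1, 2 (`localErrorBound_of_nodal`), and nondegeneracy
gives r ≥ ρd/4.

Globally, the error f is continuous: conformity makes a point of two triangles a common vertex or a
point on the line of a common edge (`IsTriangulation.common_face`), and along an edge the
interpolant depends only on data of that edge. Being Lipschitz on each closed triangle, f is
Lipschitz on the convex set closure Ω (`lipschitzOnWith_biUnion`), so its line derivatives form a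
weak gradient; this is the W^{1,1} bound.

For the Hessian the jumps are never computed. One integration by parts over Ω leaves ∫ ∂ᵢf ∂ⱼφ,
which on a triangle T is ∫ ∂ⱼ(φ ∂ᵢf) - ∫ φ ∂ⱼ∂ᵢf. The first integral is a boundary term, at most
sup|∂ᵢf| times the perimeter, and the perimeter is of order |T|/r at most.
`abs_setIntegral_lineDeriv_le` proves this without surface measure, by comparing a convex set and
its translates with a slightly dilated copy. Both terms are then of order (M d³/r²)|T|, hence of
order M h |T|, and the areas add up to |Ω|. -/

/-! ### Functions with scaled bounds on two derivatives -/

/-- `p` is twice differentiable on `K` with `|p| ≤ c`, `|∇p| ≤ c G` and `|∇²p| ≤ c G²`. -/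
def C2Bound {E : Type*} [NormedAddCommGroup E] [NormedSpace ℝ E] (K : Set E) (G c : ℝ)
    (p : E → ℝ) : Prop :=
  ∃ (p₁ : E → E →L[ℝ] ℝ) (p₂ : E → E →L[ℝ] E →L[ℝ] ℝ), ∀ x ∈ K,
    HasFDerivWithinAt p (p₁ x) K x ∧ HasFDerivWithinAt p₁ (p₂ x) K x ∧
      |p x| ≤ c ∧ ‖p₁ x‖ ≤ c * G ∧ ‖p₂ x‖ ≤ c * G ^ 2

theorem opNorm_smul_eq {E F : Type*} [NormedAddCommGroup E] [NormedSpace ℝ E]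
    [NormedAddCommGroup F] [NormedSpace ℝ F] (a : ℝ) (f : E →L[ℝ] F) : ‖a • f‖ = |a| * ‖f‖ :=
  norm_smul a f

namespace C2Bound

variable {E : Type*} [NormedAddCommGroup E] [NormedSpace ℝ E] {K : Set E} {G c d : ℝ} 
  {p q : E → ℝ}

theorem mono (hG : 0 ≤ G) (h : C2Bound K G c p) (hcd : c ≤ d) : C2Bound K G d p := by
  obtain ⟨p₁, p₂, h⟩ := h
  refine ⟨p₁, p₂, fun x hx => ?_⟩
  obtain ⟨h1, h2, h3, h4, h5⟩ := h x hx
  exact ⟨h1, h2, h3.trans hcd, h4.trans (by gcongr), h5.trans (by gcongr)⟩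

theorem congr (h : C2Bound K G c p) (hpq : ∀ x ∈ K, q x = p x) : C2Bound K G c q := by
  obtain ⟨p₁, p₂, h⟩ := h
  refine ⟨p₁, p₂, fun x hx => ?_⟩
  obtain ⟨h1, h2, h3, h4, h5⟩ := h x hx
  exact ⟨h1.congr hpq (hpq x hx), h2, by rwa [hpq x hx], h4, h5⟩

theorem add (hp : C2Bound K G c p) (hq : C2Bound K G d q) :
    C2Bound K G (c + d) (fun x => p x + q x) := by
  obtain ⟨p₁, p₂, hp⟩ := hp
  obtain ⟨q₁, q₂, hq⟩ := hq
  refine ⟨fun x => p₁ x + q₁ x, fun x => p₂ x + q₂ x, fun x hx => ?_⟩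
  obtain ⟨h1, h2, h3, h4, h5⟩ := hp x hx
  obtain ⟨k1, k2, k3, k4, k5⟩ := hq x hx
  refine ⟨h1.add k1, h2.add k2, (abs_add_le _ _).trans (add_le_add h3 k3), ?_, ?_⟩
  · rw [add_mul]
    exact (ContinuousLinearMap.opNorm_add_le _ _).trans (add_le_add h4 k4)
  · rw [add_mul]
    exact (ContinuousLinearMap.opNorm_add_le _ _).trans (add_le_add h5 k5)

theorem const_mul (a : ℝ) (hp : C2Bound K G c p) :
    C2Bound K G (|a| * c) (fun x => a * p x) := by
  obtain ⟨p₁, p₂, hp⟩ := hp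
  refine ⟨fun x => a • p₁ x, fun x => a • p₂ x, fun x hx => ?_⟩
  obtain ⟨h1, h2, h3, h4, h5⟩ := hp x hx
  refine ⟨h1.const_smul a, h2.const_smul a, ?_, ?_, ?_⟩
  · rw [abs_mul]; gcongr
  · rw [opNorm_smul_eq, mul_assoc]; gcongr
  · rw [opNorm_smul_eq, mul_assoc]; gcongr

theorem zero : C2Bound K G 0 (fun _ => 0) :=
  ⟨0, 0, fun x _ => ⟨hasFDerivWithinAt_const 0 x K, hasFDerivWithinAt_const 0 x K,
    by simp, by simp, by simpa using ContinuousLinearMap.opNorm_zero.le⟩⟩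

theorem sum {ι : Type*} (s : Finset ι) {c : ι → ℝ} {p : ι → E → ℝ}
    (h : ∀ i ∈ s, C2Bound K G (c i) (p i)) :
    C2Bound K G (∑ i ∈ s, c i) (fun x => ∑ i ∈ s, p i x) := by
  classical
  induction s using Finset.induction_on with
  | empty => simpa using zero
  | insert a s ha ih =>
    simp only [Finset.sum_insert ha]
    exact (h a (Finset.mem_insert_self a s)).add
      (ih fun i hi => h i (Finset.mem_insert_of_mem hi))

/-- The second derivative of pq has four terms, each at most c d G²; this is the 4. The lower orders
need only 1 and 2. -/
theorem mul (hc : 0 ≤ c) (hd : 0 ≤ d) (hG : 0 ≤ G) (hp : C2Bound K G c p)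
    (hq : C2Bound K G d q) : C2Bound K G (4 * c * d) (fun x => p x * q x) := by
  obtain ⟨p₁, p₂, hp⟩ := hp
  obtain ⟨q₁, q₂, hq⟩ := hq
  refine ⟨fun x => p x • q₁ x + q x • p₁ x, fun x => (p x • q₂ x + (p₁ x).smulRight (q₁ x)) +
    (q x • p₂ x + (q₁ x).smulRight (p₁ x)), fun x hx => ?_⟩
  obtain ⟨h1, h2, h3, h4, h5⟩ := hp x hx
  obtain ⟨k1, k2, k3, k4, k5⟩ := hq x hx
  have hcd : 0 ≤ c * d := mul_nonneg hc hd
  refine ⟨h1.mul k1, (h1.smul k2).add (k1.smul h2), ?_, ?_, ?_⟩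
  · rw [abs_mul]
    calc |p x| * |q x| ≤ c * d := by gcongr
      _ ≤ 4 * c * d := by linarith
  · calc ‖p x • q₁ x + q x • p₁ x‖ ≤ |p x| * ‖q₁ x‖ + |q x| * ‖p₁ x‖ := by
          refine (norm_add_le _ _).trans ?_
          rw [opNorm_smul_eq, opNorm_smul_eq]
      _ ≤ c * (d * G) + d * (c * G) := by gcongr
      _ ≤ 4 * c * d * G := by nlinarith [mul_nonneg hcd hG]
  · calc _ ≤ (|p x| * ‖q₂ x‖ + ‖p₁ x‖ * ‖q₁ x‖) + (|q x| * ‖p₂ x‖ + ‖q₁ x‖ * ‖p₁ x‖) := by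
          refine (ContinuousLinearMap.opNorm_add_le _ _).trans (add_le_add ?_ ?_) <;>
            refine (ContinuousLinearMap.opNorm_add_le _ _).trans ?_ <;>
            rw [opNorm_smul_eq, ContinuousLinearMap.norm_smulRight_apply]
      _ ≤ (c * (d * G ^ 2) + (c * G) * (d * G)) + (d * (c * G ^ 2) + (d * G) * (c * G)) := by
          gcongr
      _ = 4 * c * d * G ^ 2 := by ring

theorem sub (hp : C2Bound K G c p) (hq : C2Bound K G d q) :
    C2Bound K G (c + d) (fun x => p x - q x) := by
  have h := hp.add (hq.const_mul (-1))
  simpa [sub_eq_add_neg] using h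

theorem lipschitzOnWith (hK : Convex ℝ K) (h : C2Bound K G c p) :
    LipschitzOnWith (Real.toNNReal (c * G)) p K := by
  obtain ⟨p₁, p₂, h⟩ := h
  refine hK.lipschitzOnWith_of_nnnorm_hasFDerivWithin_le (f' := p₁) (fun x hx => (h x hx).1)
    fun x hx => ?_
  rw [← NNReal.coe_le_coe, coe_nnnorm]
  exact (h x hx).2.2.2.1.trans (Real.le_coe_toNNReal _)

end C2Bound

/-! ### Barycentric coordinates -/

/-- The vertices of a triangle as an affine basis of the plane. -/
def triBasis (t : Tri) : AffineBasis (Fin 3) ℝ Plane :=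
  ⟨t.points, t.independent, by
    rw [t.independent.affineSpan_eq_top_iff_card_eq_finrank_add_one]
    simp⟩

/-- The barycentric coordinates of a triangle. -/
def bary (t : Tri) (i : Fin 3) : Plane →ᵃ[ℝ] ℝ := (triBasis t).coord i

theorem bary_point (t : Tri) (i j : Fin 3) : bary t i (t.points j) = if i = j then 1 else 0 :=
  (triBasis t).coord_apply i j

theorem sum_bary (t : Tri) (x : Plane) : ∑ i, bary t i x = 1 :=
  (triBasis t).sum_coord_apply_eq_one x

theorem sum_bary_smul (t : Tri) (x : Plane) : ∑ i, bary t i x • t.points i = x :=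
  (triBasis t).linear_combination_coord_eq_self x

theorem closedInterior_eq_convexHull (t : Tri) :
    t.closedInterior = convexHull ℝ (Set.range t.points) :=
  t.convexHull_eq_closedInterior.symm

theorem mem_closedInterior_iff (t : Tri) (x : Plane) :
    x ∈ t.closedInterior ↔ ∀ i, 0 ≤ bary t i x := by
  rw [closedInterior_eq_convexHull]
  exact Set.ext_iff.1 (triBasis t).convexHull_eq_nonneg_coord x

theorem mem_interior_iff (t : Tri) (x : Plane) : x ∈ t.interior ↔ ∀ i, 0 < bary t i x := by
  have hx : Finset.affineCombination ℝ Finset.univ t.points (fun i => bary t i x) = x :=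
    (triBasis t).affineCombination_coord_eq_self x
  have key : x ∈ t.interior ↔ ∀ i, bary t i x ∈ Set.Ioo (0 : ℝ) 1 := by
    conv_lhs => rw [← hx]
    exact Affine.Simplex.affineCombination_mem_interior_iff (sum_bary t x)
  rw [key]
  refine ⟨fun h i => (h i).1, fun h i => ⟨h i, ?_⟩⟩
  have h1 := sum_bary t x
  rw [Fin.sum_univ_three] at h1
  have h0 := h 0
  have h2 := h 1
  have h3 := h 2
  fin_cases i <;> simp <;> linarith

theorem bary_le_one {t : Tri} {x : Plane} (hx : x ∈ t.closedInterior) (i : Fin 3) :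
    bary t i x ≤ 1 := by
  rw [mem_closedInterior_iff] at hx
  rw [← sum_bary t x]
  exact Finset.single_le_sum (fun j _ => hx j) (Finset.mem_univ i)

theorem interior_closedInterior (t : Tri) : interior t.closedInterior = t.interior := by
  ext x
  rw [mem_interior_iff, closedInterior_eq_convexHull]
  exact Set.ext_iff.1 (triBasis t).interior_convexHull x

theorem convex_closedInterior (t : Tri) : Convex ℝ t.closedInterior := by
  rw [closedInterior_eq_convexHull]; exact convex_convexHull _ _

theorem isClosed_closedInterior (t : Tri) : IsClosed t.closedInterior :=
  t.isClosed_closedInterior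

theorem isOpen_interior (t : Tri) : IsOpen t.interior := by
  rw [← interior_closedInterior]; exact _root_.isOpen_interior

theorem convex_interior (t : Tri) : Convex ℝ t.interior := by
  rw [← interior_closedInterior]; exact (convex_closedInterior t).interior

theorem nonempty_interior (t : Tri) : t.interior.Nonempty := by
  rw [← interior_closedInterior, closedInterior_eq_convexHull]
  exact (interior_convexHull_nonempty_iff_affineSpan_eq_top).2 (triBasis t).tot

theorem closure_interior (t : Tri) : closure t.interior = t.closedInterior := by
  have h := (convex_closedInterior t).closure_interior_eq_closure_of_nonempty_interior
    (by rw [interior_closedInterior]; exact nonempty_interior t)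
  rwa [interior_closedInterior, (isClosed_closedInterior t).closure_eq] at h

theorem uniqueDiffOn_closedInterior (t : Tri) : UniqueDiffOn ℝ t.closedInterior :=
  uniqueDiffOn_convex (convex_closedInterior t)
    (by rw [interior_closedInterior]; exact nonempty_interior t)

theorem isBounded_closedInterior (t : Tri) : Bornology.IsBounded t.closedInterior := by
  rw [closedInterior_eq_convexHull]
  exact isBounded_convexHull.2 (Set.finite_range _).isBounded

theorem dist_le_diam_interior (t : Tri) {x y : Plane} (hx : x ∈ t.closedInterior)
    (hy : y ∈ t.closedInterior) : ‖x - y‖ ≤ Metric.diam t.interior := by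
  rw [← Metric.diam_closure, closure_interior, ← dist_eq_norm]
  exact Metric.dist_le_diam_of_mem (isBounded_closedInterior t) hx hy

/-- The gradient of an affine function. -/
def affGrad (α : Plane →ᵃ[ℝ] ℝ) : Plane →L[ℝ] ℝ := LinearMap.toContinuousLinearMap α.linear

theorem affGrad_sub (α : Plane →ᵃ[ℝ] ℝ) (x y : Plane) : affGrad α (x - y) = α x - α y :=
  α.linearMap_vsub x y

theorem affine_eq (α : Plane →ᵃ[ℝ] ℝ) : (α : Plane → ℝ) = fun x => affGrad α x + α 0 := by
  funext y
  have := affGrad_sub α y 0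
  rw [sub_zero] at this
  linarith

theorem hasFDerivAt_affine (α : Plane →ᵃ[ℝ] ℝ) (x : Plane) : HasFDerivAt α (affGrad α) x := by
  conv => arg 1; rw [affine_eq α]
  exact (affGrad α).hasFDerivAt.add_const _

/-- A barycentric coordinate has values in [0, 1] on the triangle, so it changes by at most 1 over a
step of length r/2 from the centre. The half keeps the step inside the open ball. -/
theorem norm_affGrad_bary_le {t : Tri} {c : Plane} {r : ℝ} (hr : 0 < r)
    (hb : Metric.ball c r ⊆ t.interior) (i : Fin 3) : ‖affGrad (bary t i)‖ ≤ 2 / r := by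
  refine ContinuousLinearMap.opNorm_le_bound _ (by positivity) fun v => ?_
  rcases eq_or_ne v 0 with rfl | hv
  · simp
  have hv' : 0 < ‖v‖ := norm_pos_iff.2 hv
  set s : ℝ := r / 2 / ‖v‖ with hs
  have hs0 : 0 < s := by positivity
  have hc : c ∈ t.closedInterior :=
    t.interior_subset_closedInterior (hb (Metric.mem_ball_self hr))
  have hw : c + s • v ∈ t.closedInterior := by
    refine t.interior_subset_closedInterior (hb ?_)
    rw [Metric.mem_ball, dist_eq_norm, add_sub_cancel_left, norm_smul, Real.norm_eq_abs,
      abs_of_pos hs0, hs, div_mul_cancel₀ _ hv'.ne']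
    linarith
  have h1 := affGrad_sub (bary t i) (c + s • v) c
  rw [add_sub_cancel_left, map_smul, smul_eq_mul] at h1
  have h2 : |s * affGrad (bary t i) v| ≤ 1 := by
    rw [h1, abs_le]
    have a1 := bary_le_one hc i
    have a2 := bary_le_one hw i
    have a3 := (mem_closedInterior_iff t c).1 hc i
    have a4 := (mem_closedInterior_iff t _).1 hw i
    constructor <;> linarith
  rw [abs_mul, abs_of_pos hs0] at h2
  rw [Real.norm_eq_abs]
  calc |affGrad (bary t i) v| = s * |affGrad (bary t i) v| / s := by field_simp
    _ ≤ 1 / s := by gcongr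
    _ = 2 / r * ‖v‖ := by rw [hs]; field_simp

theorem c2Bound_bary {t : Tri} {c : Plane} {r : ℝ} (hr : 0 < r)
    (hb : Metric.ball c r ⊆ t.interior) (i : Fin 3) :
    C2Bound t.closedInterior (2 / r) 1 (bary t i) := by
  refine ⟨fun _ => affGrad (bary t i), fun _ => 0, fun x hx => ⟨(hasFDerivAt_affine (bary t i) x).hasFDerivWithinAt,
    hasFDerivWithinAt_const _ _ _, ?_, ?_, ?_⟩⟩
  · rw [abs_of_nonneg ((mem_closedInterior_iff t x).1 hx i)]
    exact bary_le_one hx i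
  · rw [one_mul]; exact norm_affGrad_bary_le hr hb i
  · exact ContinuousLinearMap.opNorm_zero.le.trans (by positivity)

/-- Shows that the diameter is positive and that the scale 1/diam is at most the scale 2/r. -/
theorem half_radius_le_diam {t : Tri} {c : Plane} {r : ℝ} (hr : 0 < r)
    (hb : Metric.ball c r ⊆ t.interior) : r / 2 ≤ Metric.diam t.interior := by
  have hc : c ∈ t.closedInterior :=
    t.interior_subset_closedInterior (hb (Metric.mem_ball_self hr))
  set w : Plane := EuclideanSpace.single 0 (r / 2)
  have hw : ‖w‖ = r / 2 := by simp [w, abs_of_pos hr]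
  have hcw : c + w ∈ t.closedInterior := by
    refine t.interior_subset_closedInterior (hb ?_)
    rw [Metric.mem_ball, dist_eq_norm, add_sub_cancel_left, hw]
    linarith
  have h := dist_le_diam_interior t hcw hc
  rwa [add_sub_cancel_left, hw] at h

/-! ### Polynomial functions -/

theorem IsPoly.mono {k l : ℕ} {p : Plane → ℝ} (hp : IsPoly k p) (h : k ≤ l) : IsPoly l p := by
  obtain ⟨P, hP, hx⟩ := hp
  exact ⟨P, hP.trans h, hx⟩

theorem IsPoly.add {k : ℕ} {p q : Plane → ℝ} (hp : IsPoly k p) (hq : IsPoly k q) :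
    IsPoly k (fun x => p x + q x) := by
  obtain ⟨P, hP, hx⟩ := hp
  obtain ⟨Q, hQ, hy⟩ := hq
  exact ⟨P + Q, (MvPolynomial.totalDegree_add P Q).trans (max_le hP hQ), fun x => by
    simp only [hx, hy, map_add]⟩

theorem IsPoly.mul {k l : ℕ} {p q : Plane → ℝ} (hp : IsPoly k p) (hq : IsPoly l q) :
    IsPoly (k + l) (fun x => p x * q x) := by
  obtain ⟨P, hP, hx⟩ := hp
  obtain ⟨Q, hQ, hy⟩ := hq
  exact ⟨P * Q, (MvPolynomial.totalDegree_mul P Q).trans (add_le_add hP hQ), fun x => by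
    simp only [hx, hy, map_mul]⟩

theorem isPoly_const (k : ℕ) (a : ℝ) : IsPoly k (fun _ => a) :=
  ⟨MvPolynomial.C a, by simp, fun x => by simp⟩

theorem isPoly_coord (i : Fin 2) : IsPoly 1 (fun x => x i) :=
  ⟨MvPolynomial.X i, by simp, fun x => by simp⟩

theorem IsPoly.const_mul {k : ℕ} {p : Plane → ℝ} (a : ℝ) (hp : IsPoly k p) :
    IsPoly k (fun x => a * p x) := by
  simpa using (isPoly_const 0 a).mul hp

theorem IsPoly.sub {k : ℕ} {p q : Plane → ℝ} (hp : IsPoly k p) (hq : IsPoly k q) :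
    IsPoly k (fun x => p x - q x) := by
  simpa [sub_eq_add_neg] using hp.add (hq.const_mul (-1))

theorem plane_eq_sum (x : Plane) :
    x = x 0 • EuclideanSpace.single 0 (1 : ℝ) + x 1 • EuclideanSpace.single 1 (1 : ℝ) := by
  ext i; fin_cases i <;> simp

theorem isPoly_clm (f : Plane →L[ℝ] ℝ) : IsPoly 1 f := by
  have h : (f : Plane → ℝ) = fun x => f (EuclideanSpace.single 0 1) * x 0 +
      f (EuclideanSpace.single 1 1) * x 1 := by
    funext x
    conv_lhs => rw [plane_eq_sum x]
    rw [map_add, map_smul, map_smul, smul_eq_mul, smul_eq_mul]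
    ring
  rw [h]
  exact ((isPoly_coord 0).const_mul _).add ((isPoly_coord 1).const_mul _)

theorem isPoly_affine (α : Plane →ᵃ[ℝ] ℝ) : IsPoly 1 α := by
  rw [affine_eq α]
  exact (isPoly_clm _).add (isPoly_const _ _)

theorem affine_eq_sum_bary (t : Tri) (α : Plane →ᵃ[ℝ] ℝ) (x : Plane) :
    α x = ∑ i, bary t i x * α (t.points i) := by
  have h := congrArg (affGrad α) (sum_bary_smul t x)
  have h1 := sum_bary t x
  rw [map_sum] at h
  simp only [map_smul, smul_eq_mul] at h
  have h2 : ∀ y, α y = affGrad α y + α 0 := congrFun (affine_eq α)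
  rw [h2 x, Finset.sum_congr rfl fun i _ => by rw [h2 (t.points i), mul_add],
    Finset.sum_add_distrib, h, ← Finset.sum_mul, h1, one_mul]

/-- Polynomial functions of degree at most `k` are spanned by monomials. -/
theorem IsPoly.induction_monomial {k : ℕ} {Q : (Plane → ℝ) → Prop}
    (hadd : ∀ p q, Q p → Q q → Q (fun x => p x + q x))
    (hsmul : ∀ (a : ℝ) p, Q p → Q (fun x => a * p x))
    (hmon : ∀ a b : ℕ, a + b ≤ k → Q (fun x => x 0 ^ a * x 1 ^ b)) {p : Plane → ℝ}
    (hp : IsPoly k p) : Q p := by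
  obtain ⟨P, hP, hx⟩ := hp
  have hsum : ∀ s : Finset (Fin 2 →₀ ℕ), s ⊆ P.support →
      Q (fun x => ∑ m ∈ s, MvPolynomial.coeff m P * (x 0 ^ m 0 * x 1 ^ m 1)) := by
    intro s
    induction s using Finset.induction_on with
    | empty =>
      intro _
      simpa using hsmul 0 _ (hmon 0 0 (Nat.zero_le _))
    | insert m s hm ih =>
      intro hs
      have hd : m 0 + m 1 ≤ k := by
        have := (MvPolynomial.le_totalDegree (hs (Finset.mem_insert_self m s))).trans hP
        rwa [Finsupp.sum_fintype _ _ (fun _ => rfl), Fin.sum_univ_two] at this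
      simp only [Finset.sum_insert hm]
      exact hadd _ _ (hsmul _ _ (hmon _ _ hd)) (ih fun i hi => hs (Finset.mem_insert_of_mem hi))
  convert hsum P.support subset_rfl using 1
  funext x
  rw [hx, MvPolynomial.eval_eq']
  simp [Fin.prod_univ_two]

/-- The coordinates of the plane as affine functions. -/
def coordAff (i : Fin 2) : Plane →ᵃ[ℝ] ℝ :=
  (EuclideanSpace.proj i : Plane →L[ℝ] ℝ).toLinearMap.toAffineMap

theorem coordAff_apply (i : Fin 2) (x : Plane) : coordAff i x = x i := rfl

/-- Polynomial functions of degree at most `2` are spanned by products of two affine functions. -/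
theorem IsPoly.induction_quadratic {Q : (Plane → ℝ) → Prop}
    (hadd : ∀ p q, Q p → Q q → Q (fun x => p x + q x))
    (hsmul : ∀ (a : ℝ) p, Q p → Q (fun x => a * p x))
    (hmul : ∀ α β : Plane →ᵃ[ℝ] ℝ, Q (fun x => α x * β x)) {p : Plane → ℝ}
    (hp : IsPoly 2 p) : Q p := by
  refine IsPoly.induction_monomial hadd hsmul (fun a b hd => ?_) hp
  have ha : a ≤ 2 := by omega
  have hb : b ≤ 2 := by omega
  set o : Plane →ᵃ[ℝ] ℝ := AffineMap.const ℝ Plane 1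
  have ho : ∀ x : Plane, o x = 1 := fun x => rfl
  interval_cases a <;> interval_cases b <;> first | omega | skip
  · convert hmul o o using 2 with x; simp [ho]
  · convert hmul o (coordAff 1) using 2 with x; simp [coordAff_apply, ho]
  · convert hmul (coordAff 1) (coordAff 1) using 2 with x; simp only [coordAff_apply]; ring
  · convert hmul o (coordAff 0) using 2 with x; simp [coordAff_apply, ho]
  · convert hmul (coordAff 0) (coordAff 1) using 2 with x; simp only [coordAff_apply]; ring
  · convert hmul (coordAff 0) (coordAff 0) using 2 with x; simp only [coordAff_apply]; ring

/-- Polynomial functions of degree at most `3` are spanned by products of three affine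
functions. -/
theorem IsPoly.induction_cubic {Q : (Plane → ℝ) → Prop}
    (hadd : ∀ p q, Q p → Q q → Q (fun x => p x + q x))
    (hsmul : ∀ (a : ℝ) p, Q p → Q (fun x => a * p x))
    (hmul : ∀ α β γ : Plane →ᵃ[ℝ] ℝ, Q (fun x => α x * β x * γ x)) {p : Plane → ℝ}
    (hp : IsPoly 3 p) : Q p := by
  refine IsPoly.induction_monomial hadd hsmul (fun a b hd => ?_) hp
  have ha : a ≤ 3 := by omega
  have hb : b ≤ 3 := by omega
  set o : Plane →ᵃ[ℝ] ℝ := AffineMap.const ℝ Plane 1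
  have ho : ∀ x : Plane, o x = 1 := fun x => rfl
  set X := coordAff 0
  set Y := coordAff 1
  have hX : ∀ x : Plane, X x = x 0 := fun x => rfl
  have hY : ∀ x : Plane, Y x = x 1 := fun x => rfl
  interval_cases a <;> interval_cases b <;> first | omega | skip
  · convert hmul o o o using 2 with x; simp only [ho]; ring
  · convert hmul o o Y using 2 with x; simp only [hY, ho]; ring
  · convert hmul o Y Y using 2 with x; simp only [hY, ho]; ring
  · convert hmul Y Y Y using 2 with x; simp only [hY]; ring
  · convert hmul o o X using 2 with x; simp only [hX, ho]; ring
  · convert hmul o X Y using 2 with x; simp only [hX, hY, ho]; ring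
  · convert hmul X Y Y using 2 with x; simp only [hX, hY]; ring
  · convert hmul o X X using 2 with x; simp only [hX, ho]; ring
  · convert hmul X X Y using 2 with x; simp only [hX, hY]; ring
  · convert hmul X X X using 2 with x; simp only [hX]; ring

/-! ### Explicit shape functions -/

/-- `shape` is an arbitrary choice among dual bases, so uniqueness is needed: when a chosen function
is expanded by `hN`, its coefficients are Kronecker deltas. -/
theorem shape_eq {ι : Type} [Fintype ι] [DecidableEq ι] {k : ℕ} {N : ι → (Plane → ℝ) → ℝ}
    {ψ : ι → Plane → ℝ} (hψ : IsDualBasis k N ψ)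
    (hN : ∀ p, IsPoly k p → ∀ x, p x = ∑ i, N i p * ψ i x) : shape k N = ψ := by
  have h : IsDualBasis k N (shape k N) := Classical.epsilon_spec ⟨ψ, hψ⟩
  funext j x
  rw [hN _ (h.1 j) x]
  simp [h.2]

/-- The shape functions of the quadratic Lagrange triangle in barycentric coordinates. -/
def lagrangeShape (t : Tri) : Fin 3 ⊕ Fin 3 → Plane → ℝ
  | Sum.inl i, x => bary t i x * (2 * bary t i x + -1)
  | Sum.inr i, x => 4 * (bary t (i + 1) x * bary t (i + 2) x)

theorem affine_midpoint (α : Plane →ᵃ[ℝ] ℝ) (a b : Plane) :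
    α (midpoint ℝ a b) = (α a + α b) / 2 := by
  rw [α.map_midpoint, midpoint_eq_smul_add, smul_eq_mul]
  simp
  ring

theorem lagrange_dual (t : Tri) : IsDualBasis 2 (lagrangeNodal t) (lagrangeShape t) := by
  constructor
  · rintro (i | i)
    · exact (isPoly_affine _).mul (((isPoly_affine _).const_mul 2).add (isPoly_const _ _))
    · exact ((isPoly_affine (bary t (i + 1))).mul (isPoly_affine (bary t (i + 2)))).const_mul 4
  · rintro (i | i) (j | j) <;>
    simp only [lagrangeNodal, lagrangeShape, affine_midpoint, bary_point] <;>
    fin_cases i <;> fin_cases j <;> simp <;> norm_num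

/-- Unisolvence without a dimension count. For a product of two affine functions both sides are
polynomials in the vertex values and the barycentric coordinates of x, equal once λ₂ = 1 - λ₀ - λ₁
is substituted. -/
theorem lagrange_repr (t : Tri) (p : Plane → ℝ) (hp : IsPoly 2 p) (x : Plane) :
    p x = ∑ i, lagrangeNodal t i p * lagrangeShape t i x := by
  refine IsPoly.induction_quadratic (Q := fun p => p x = ∑ i, lagrangeNodal t i p *
    lagrangeShape t i x) ?_ ?_ ?_ hp
  · intro p q hp hq
    simp only [Fintype.sum_sum_type, lagrangeNodal] at hp hq ⊢
    rw [hp, hq]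
    simp only [add_mul, Finset.sum_add_distrib]
    ring
  · intro a p hp
    simp only [Fintype.sum_sum_type, lagrangeNodal] at hp ⊢
    rw [hp]
    simp only [mul_assoc, ← Finset.mul_sum, mul_add]
  · intro α β
    simp only [Fintype.sum_sum_type, lagrangeNodal, lagrangeShape, affine_midpoint,
      affine_eq_sum_bary t α x, affine_eq_sum_bary t β x]
    have h1 := sum_bary t x
    simp only [Fin.sum_univ_three] at h1 ⊢
    rw [show bary t 2 x = 1 - bary t 0 x - bary t 1 x by linarith]
    simp only [show (0 + 1 : Fin 3) = 1 from rfl, show (0 + 2 : Fin 3) = 2 from rfl,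
      show (1 + 1 : Fin 3) = 2 from rfl, show (1 + 2 : Fin 3) = 0 from rfl,
      show (2 + 1 : Fin 3) = 0 from rfl, show (2 + 2 : Fin 3) = 1 from rfl]
    rw [show bary t 2 x = 1 - bary t 0 x - bary t 1 x by linarith]
    ring

theorem lagrangeLocal_eq (t : Tri) (u : Plane → ℝ) (x : Plane) :
    lagrangeLocal t u x = ∑ i, lagrangeNodal t i u * lagrangeShape t i x := by
  rw [lagrangeLocal, localInterp, shape_eq (lagrange_dual t) (lagrange_repr t)]

/-- The shape functions of the cubic Hermite triangle in barycentric coordinates. -/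
def hermiteShape (t : Tri) :
    Fin 3 ⊕ Unit ⊕ {p : Fin 3 × Fin 3 // p.1 ≠ p.2} → Plane → ℝ
  | Sum.inl i, x => bary t i x * bary t i x * (-2 * bary t i x + 3) -
      7 * (bary t 0 x * bary t 1 x * bary t 2 x)
  | Sum.inr (Sum.inl _), x => 27 * (bary t 0 x * bary t 1 x * bary t 2 x)
  | Sum.inr (Sum.inr p), x => bary t p.1.1 x * bary t p.1.1 x * bary t p.1.2 x -
      bary t 0 x * bary t 1 x * bary t 2 x

theorem hasFDerivAt_mul_affine (α β γ : Plane →ᵃ[ℝ] ℝ) (x : Plane) :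
    HasFDerivAt (fun y => α y * β y * γ y)
      ((α x * β x) • affGrad γ + γ x • (α x • affGrad β + β x • affGrad α)) x :=
  ((hasFDerivAt_affine α x).mul (hasFDerivAt_affine β x)).mul (hasFDerivAt_affine γ x)

theorem fderivWithin_eq (t : Tri) {p : Plane → ℝ} {p' : Plane →L[ℝ] ℝ} (i : Fin 3)
    (h : HasFDerivAt p p' (t.points i)) :
    fderivWithin ℝ p t.closedInterior (t.points i) = p' :=
  h.hasFDerivWithinAt.fderivWithin
    (uniqueDiffOn_closedInterior t _ (t.point_mem_closedInterior i))

theorem affine_centroid (t : Tri) (α : Plane →ᵃ[ℝ] ℝ) :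
    α (Finset.univ.centroid ℝ t.points) =
      (α (t.points 0) + α (t.points 1) + α (t.points 2)) / 3 := by
  rw [affine_eq_sum_bary t]
  have h : ∀ i, bary t i (Finset.univ.centroid ℝ t.points) = 1 / 3 := by
    intro i
    have h := (triBasis t).coord_apply_centroid (Finset.mem_univ i)
    rw [Finset.card_univ, Fintype.card_fin] at h
    rw [one_div]
    exact h
  simp only [h, Fin.sum_univ_three]
  ring

theorem sum_offDiag (f : Fin 3 × Fin 3 → ℝ) :
    ∑ p : {p : Fin 3 × Fin 3 // p.1 ≠ p.2}, f p.1 =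
      f (0, 1) + f (0, 2) + f (1, 0) + f (1, 2) + f (2, 0) + f (2, 1) := by
  rw [← Finset.sum_subtype (Finset.univ.filter fun p : Fin 3 × Fin 3 => p.1 ≠ p.2)
    (fun p => by simp) f, Finset.sum_filter, Fintype.sum_prod_type]
  simp [Fin.sum_univ_three]
  ring

theorem affGrad_bary_edge (t : Tri) (i j k : Fin 3) :
    affGrad (bary t k) (t.points j - t.points i) =
      (if k = j then 1 else 0) - (if k = i then 1 else 0) := by
  rw [affGrad_sub, bary_point, bary_point]

/-- The gradients of the Hermite shape functions. -/
def hermiteShapeGrad (t : Tri) :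
    Fin 3 ⊕ Unit ⊕ {p : Fin 3 × Fin 3 // p.1 ≠ p.2} → Plane → Plane →L[ℝ] ℝ
  | Sum.inl i, x => (6 * bary t i x * (1 - bary t i x)) • affGrad (bary t i) -
      (7 : ℝ) • ((bary t 0 x * bary t 1 x) • affGrad (bary t 2) + bary t 2 x •
        (bary t 0 x • affGrad (bary t 1) + bary t 1 x • affGrad (bary t 0)))
  | Sum.inr (Sum.inl _), x =>
      (27 : ℝ) • ((bary t 0 x * bary t 1 x) • affGrad (bary t 2) + bary t 2 x •
        (bary t 0 x • affGrad (bary t 1) + bary t 1 x • affGrad (bary t 0)))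
  | Sum.inr (Sum.inr p), x =>
      ((bary t p.1.1 x * bary t p.1.1 x) • affGrad (bary t p.1.2) + bary t p.1.2 x •
        (bary t p.1.1 x • affGrad (bary t p.1.1) + bary t p.1.1 x • affGrad (bary t p.1.1))) -
      ((bary t 0 x * bary t 1 x) • affGrad (bary t 2) + bary t 2 x •
        (bary t 0 x • affGrad (bary t 1) + bary t 1 x • affGrad (bary t 0)))

theorem hasFDerivAt_hermiteShape (t : Tri)
    (j : Fin 3 ⊕ Unit ⊕ {p : Fin 3 × Fin 3 // p.1 ≠ p.2}) (x : Plane) :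
    HasFDerivAt (hermiteShape t j) (hermiteShapeGrad t j x) x := by
  have hb := hasFDerivAt_mul_affine (bary t 0) (bary t 1) (bary t 2) x
  rcases j with i | _ | p
  · have h1 := hasFDerivAt_affine (bary t i) x
    refine (((h1.mul h1).mul ((h1.const_mul (-2)).add_const 3)).sub
      (hb.const_mul 7)).congr_fderiv ?_
    ext v
    simp only [hermiteShapeGrad, add_apply, sub_apply, smul_apply, smul_eq_mul, Pi.mul_apply]
    ring
  · exact hb.const_mul 27
  · exact (hasFDerivAt_mul_affine _ _ _ x).sub hb

/-- The bubble λ₀λ₁λ₂ has zero value and gradient at the vertices and equals 1/27 at the barycenter.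
Subtracting 7 bubbles or 1 bubble cancels the barycenter values 7/27 of λᵢ²(3 - 2λᵢ) and 1/27 of
λᵢ²λⱼ. -/
theorem hermite_dual (t : Tri) : IsDualBasis 3 (hermiteNodal t) (hermiteShape t) := by
  have ha := fun i => isPoly_affine (bary t i)
  constructor
  · have hb := ((ha 0).mul (ha 1)).mul (ha 2)
    rintro (i | _ | p)
    · exact (((ha i).mul (ha i)).mul (((ha i).const_mul (-2)).add (isPoly_const 1 3))).sub
        (hb.const_mul 7)
    · exact hb.const_mul 27
    · exact (((ha _).mul (ha _)).mul (ha _)).sub hb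
  · rintro (i | _ | ⟨⟨i, j⟩, hij⟩) k
    · rcases k with k | _ | ⟨⟨k, l⟩, hkl⟩ <;>
      simp only [hermiteNodal, hermiteShape, bary_point]
      · fin_cases i <;> fin_cases k <;> simp <;> norm_num
      · fin_cases i <;> simp
      · fin_cases i <;> fin_cases k <;> fin_cases l <;> simp at hkl ⊢
    · rcases k with k | _ | ⟨⟨k, l⟩, hkl⟩ <;>
      simp only [hermiteNodal, hermiteShape, affine_centroid, bary_point]
      · fin_cases k <;> simp <;> norm_num
      · simp; norm_num
      · fin_cases k <;> fin_cases l <;> simp at hkl ⊢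
    · simp only [hermiteNodal]
      rw [fderivWithin_eq t i (hasFDerivAt_hermiteShape t k _)]
      rcases k with k | _ | ⟨⟨k, l⟩, hkl⟩ <;>
      simp only [hermiteShapeGrad, bary_point, add_apply,
        sub_apply, smul_apply, affGrad_bary_edge, smul_eq_mul]
      · fin_cases i <;> fin_cases k <;> simp
      · fin_cases i <;> simp
      · fin_cases i <;> fin_cases j <;> simp at hij <;>
          fin_cases k <;> fin_cases l <;> simp at hkl ⊢

theorem hermite_repr (t : Tri) (p : Plane → ℝ) (hp : IsPoly 3 p) (x : Plane) :
    p x = ∑ i, hermiteNodal t i p * hermiteShape t i x := by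
  have hu := fun i => uniqueDiffOn_closedInterior t _ (t.point_mem_closedInterior i)
  -- Differentiability is carried through the induction because the linearity of the derivative
  -- nodal variables requires it.
  refine (IsPoly.induction_cubic (Q := fun p => Differentiable ℝ p ∧ p x = ∑ i, hermiteNodal t i p *
    hermiteShape t i x) ?_ ?_ ?_ hp).2
  · rintro p q ⟨dp, hp⟩ ⟨dq, hq⟩
    refine ⟨dp.add dq, ?_⟩
    have hN : ∀ i, hermiteNodal t i (fun x => p x + q x) =
        hermiteNodal t i p + hermiteNodal t i q := by
      rintro (i | _ | p)
      · rfl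
      · rfl
      · simp only [hermiteNodal]
        rw [fderivWithin_fun_add (hu _) (dp _).differentiableWithinAt (dq _).differentiableWithinAt]
        rfl
    simp only [hN, add_mul, Finset.sum_add_distrib, ← hp, ← hq]
  · rintro a p ⟨dp, hp⟩
    refine ⟨dp.const_mul a, ?_⟩
    have hN : ∀ i, hermiteNodal t i (fun x => a * p x) = a * hermiteNodal t i p := by
      rintro (i | _ | p)
      · rfl
      · rfl
      · simp only [hermiteNodal]
        rw [fderivWithin_const_mul (hu _) (dp _).differentiableWithinAt]
        rfl
    simp only [hN, mul_assoc, ← Finset.mul_sum, ← hp]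
  · intro α β γ
    refine ⟨fun y => (hasFDerivAt_mul_affine α β γ y).differentiableAt, ?_⟩
    have hN : ∀ p : {p : Fin 3 × Fin 3 // p.1 ≠ p.2}, hermiteNodal t (Sum.inr (Sum.inr p))
        (fun x => α x * β x * γ x) = (fun p : Fin 3 × Fin 3 =>
          α (t.points p.1) * β (t.points p.1) * (γ (t.points p.2) - γ (t.points p.1)) +
          γ (t.points p.1) * (α (t.points p.1) * (β (t.points p.2) - β (t.points p.1)) +
            β (t.points p.1) * (α (t.points p.2) - α (t.points p.1)))) p.1 := by
      intro p
      simp only [hermiteNodal]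
      rw [fderivWithin_eq t _ (hasFDerivAt_mul_affine α β γ _)]
      simp only [add_apply, smul_apply, smul_eq_mul,
        affGrad_sub]
    have hS : ∀ p : {p : Fin 3 × Fin 3 // p.1 ≠ p.2}, hermiteShape t (Sum.inr (Sum.inr p)) x =
        (fun p : Fin 3 × Fin 3 => bary t p.1 x * bary t p.1 x * bary t p.2 x -
          bary t 0 x * bary t 1 x * bary t 2 x) p.1 := fun p => rfl
    rw [Fintype.sum_sum_type, Fintype.sum_sum_type]
    simp only [hN, hS]
    rw [sum_offDiag (fun p => (α (t.points p.1) * β (t.points p.1) *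
          (γ (t.points p.2) - γ (t.points p.1)) +
          γ (t.points p.1) * (α (t.points p.1) * (β (t.points p.2) - β (t.points p.1)) +
            β (t.points p.1) * (α (t.points p.2) - α (t.points p.1)))) *
          (bary t p.1 x * bary t p.1 x * bary t p.2 x -
          bary t 0 x * bary t 1 x * bary t 2 x))]
    simp only [hermiteNodal, hermiteShape, affine_centroid, Finset.univ_unique,
      Finset.sum_singleton, affine_eq_sum_bary t α x, affine_eq_sum_bary t β x,
      affine_eq_sum_bary t γ x]
    have h1 := sum_bary t x
    simp only [Fin.sum_univ_three] at h1 ⊢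
    rw [show bary t 2 x = 1 - bary t 0 x - bary t 1 x by linarith]
    ring

theorem hermiteLocal_eq (t : Tri) (u : Plane → ℝ) (x : Plane) :
    hermiteLocal t u x = ∑ i, hermiteNodal t i u * hermiteShape t i x := by
  rw [hermiteLocal, localInterp, shape_eq (hermite_dual t) (hermite_repr t)]

/-! ### Local interpolation error -/

theorem C2Bound.mono_scale {E : Type*} [NormedAddCommGroup E] [NormedSpace ℝ E] {K : Set E}
    {G G' c : ℝ} {p : E → ℝ} (h : C2Bound K G c p) (hc : 0 ≤ c) (hG : 0 ≤ G) (hGG : G ≤ G') :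
    C2Bound K G' c p := by
  obtain ⟨p₁, p₂, h⟩ := h
  refine ⟨p₁, p₂, fun x hx => ?_⟩
  obtain ⟨h1, h2, h3, h4, h5⟩ := h x hx
  exact ⟨h1, h2, h3, h4.trans (by gcongr), h5.trans (by gcongr)⟩

theorem C2Bound.const {E : Type*} [NormedAddCommGroup E] [NormedSpace ℝ E] {K : Set E}
    {G : ℝ} (hG : 0 ≤ G) (a : ℝ) : C2Bound K G |a| (fun _ => a) :=
  ⟨0, 0, fun x _ => ⟨hasFDerivWithinAt_const _ x K, hasFDerivWithinAt_const _ x K,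
    le_rfl, by simpa using mul_nonneg (abs_nonneg a) hG,
    ContinuousLinearMap.opNorm_zero.le.trans (by positivity)⟩⟩

/-- Taylor's formula of order two with remainder, as bounds on the remainder and its first two
derivatives. -/
theorem c2Bound_taylor {E : Type*} [NormedAddCommGroup E] [NormedSpace ℝ E] {K : Set E}
    (hK : Convex ℝ K) {u : E → ℝ} {u₁ : E → E →L[ℝ] ℝ} {u₂ : E → E →L[ℝ] E →L[ℝ] ℝ}
    {M d : ℝ} (hM0 : 0 ≤ M) (hd : 0 < d)
    (h₁ : ∀ x ∈ K, HasFDerivWithinAt u (u₁ x) K x)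
    (h₂ : ∀ x ∈ K, HasFDerivWithinAt u₁ (u₂ x) K x)
    {a : E} (ha : a ∈ K) (h₃ : ∀ x ∈ K, ‖u₂ x - u₂ a‖ ≤ M * ‖x - a‖)
    (hsymm : ∀ v w, u₂ a v w = u₂ a w v) (hdiam : ∀ x ∈ K, ‖x - a‖ ≤ d) :
    C2Bound K (1 / d) (M * d ^ 3)
      (fun x => u x - (u a + u₁ a (x - a) + 1 / 2 * u₂ a (x - a) (x - a))) := by
  have hs : ∀ x : E, HasFDerivAt (fun y : E => y - a) (ContinuousLinearMap.id ℝ E) x :=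
    fun x => (hasFDerivAt_id x).sub_const a
  have hq2 : ∀ x : E, HasFDerivAt (fun y => u₂ a (y - a)) (u₂ a) x := fun x =>
    (u₂ a).hasFDerivAt.comp x (hs x)
  -- The derivative of half the quadratic form is u₂ a (x - a) only because u₂ a is symmetric.
  have hq1 : ∀ x : E, HasFDerivAt
      (fun y => u a + u₁ a (y - a) + 1 / 2 * u₂ a (y - a) (y - a)) (u₁ a + u₂ a (x - a)) x := by
    intro x
    have e1 := (((u₁ a).hasFDerivAt.comp x (hs x)).const_add (u a)).add
      (((hq2 x).clm_apply (hs x)).const_mul (1 / 2))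
    refine e1.congr_fderiv ?_
    ext v
    simp [hsymm v]
    ring
  -- The remainder and its first derivative vanish at a, so the mean value inequality, applied twice
  -- from the second derivative downwards, gains a factor d each time.
  have b2 : ∀ x ∈ K, ‖u₂ x - u₂ a‖ ≤ M * d := fun x hx =>
    (h₃ x hx).trans (mul_le_mul_of_nonneg_left (hdiam x hx) hM0)
  have d2 : ∀ x ∈ K, HasFDerivWithinAt (fun y => u₁ y - (u₁ a + u₂ a (y - a))) (u₂ x - u₂ a) K x :=
    fun x hx => (h₂ x hx).sub ((hq2 x).const_add (u₁ a)).hasFDerivWithinAt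
  have b1 : ∀ x ∈ K, ‖u₁ x - (u₁ a + u₂ a (x - a))‖ ≤ M * d ^ 2 := by
    intro x hx
    have := hK.norm_image_sub_le_of_norm_hasFDerivWithin_le d2 b2 ha hx
    simp only [sub_self, map_zero, add_zero, sub_zero] at this
    refine this.trans ?_
    rw [pow_two, ← mul_assoc]
    exact mul_le_mul_of_nonneg_left (hdiam x hx) (by positivity)
  have d1 : ∀ x ∈ K, HasFDerivWithinAt
      (fun y => u y - (u a + u₁ a (y - a) + 1 / 2 * u₂ a (y - a) (y - a)))
      (u₁ x - (u₁ a + u₂ a (x - a))) K x :=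
    fun x hx => (h₁ x hx).sub (hq1 x).hasFDerivWithinAt
  have b0 : ∀ x ∈ K, |u x - (u a + u₁ a (x - a) + 1 / 2 * u₂ a (x - a) (x - a))| ≤ M * d ^ 3 := by
    intro x hx
    have := hK.norm_image_sub_le_of_norm_hasFDerivWithin_le d1 b1 ha hx
    simp only [sub_self, map_zero, add_zero, mul_zero, sub_zero] at this
    refine this.trans ?_
    rw [pow_succ d 2, ← mul_assoc]
    exact mul_le_mul_of_nonneg_left (hdiam x hx) (by positivity)
  refine ⟨_, _, fun x hx => ⟨d1 x hx, d2 x hx, b0 x hx, (b1 x hx).trans_eq ?_,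
    (b2 x hx).trans_eq ?_⟩⟩ <;> field_simp

theorem isPoly_taylor (b : ℝ) (L : Plane →L[ℝ] ℝ) (B : Plane →L[ℝ] Plane →L[ℝ] ℝ) (a : Plane) :
    IsPoly 2 (fun x => b + L (x - a) + 1 / 2 * B (x - a) (x - a)) := by
  have hL : ∀ L : Plane →L[ℝ] ℝ, IsPoly 1 (fun x => L (x - a)) := fun L => by
    simpa [map_sub] using (isPoly_clm L).sub (isPoly_const 1 (L a))
  have hB : (fun x => B (x - a) (x - a)) = fun x =>
      (EuclideanSpace.proj 0 : Plane →L[ℝ] ℝ) (x - a) * B (EuclideanSpace.single 0 1) (x - a) +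
      (EuclideanSpace.proj 1 : Plane →L[ℝ] ℝ) (x - a) * B (EuclideanSpace.single 1 1) (x - a) := by
    funext x
    conv_lhs => rw [show B (x - a) = B _ from congrArg B (plane_eq_sum (x - a))]
    simp
  refine (((isPoly_const 2 b).add ((hL L).mono one_le_two))).add (IsPoly.const_mul _ ?_)
  rw [hB]
  exact ((hL _).mul (hL _)).add ((hL _).mul (hL _))

/-- The interpolation error in terms of bounds on the shape functions and a function that differs from
`u` by a function which is reproduced by the interpolation. -/
theorem c2Bound_interp_error {ι : Type} [Fintype ι] {N : ι → (Plane → ℝ) → ℝ}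
    {ψ : ι → Plane → ℝ} {K : Set Plane} {G c B : ℝ} {u q : Plane → ℝ} (hG : 0 ≤ G) (hB : 0 ≤ B)
    (hq : ∀ x, q x = ∑ i, N i q * ψ i x) (hN : ∀ i, N i u = N i q + N i (fun x => u x - q x))
    (hv : C2Bound K G c (fun x => u x - q x)) (hNv : ∀ i, |N i (fun x => u x - q x)| ≤ c)
    (hψ : ∀ i, C2Bound K G B (ψ i)) :
    C2Bound K G (c + Fintype.card ι * (c * B)) (fun x => u x - ∑ i, N i u * ψ i x) := by
  have h1 : C2Bound K G (∑ _i : ι, c * B)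
      (fun x => ∑ i, N i (fun x => u x - q x) * ψ i x) :=
    C2Bound.sum _ fun i _ => ((hψ i).const_mul _).mono hG (mul_le_mul_of_nonneg_right (hNv i) hB)
  rw [Finset.sum_const, Finset.card_univ, nsmul_eq_mul] at h1
  refine (hv.sub h1).congr fun x _ => ?_
  simp only [hN, add_mul, Finset.sum_add_distrib, ← hq]
  ring

/-- The worst case is 4 λⱼλₖ, where `C2Bound.mul` contributes another 4; the vertex functions need
only 12. -/
theorem c2Bound_lagrangeShape {t : Tri} {c : Plane} {r : ℝ} (hr : 0 < r)
    (hb : Metric.ball c r ⊆ t.interior) (i : Fin 3 ⊕ Fin 3) :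
    C2Bound t.closedInterior (2 / r) 16 (lagrangeShape t i) := by
  have hG : 0 ≤ 2 / r := by positivity
  have hl := c2Bound_bary hr hb
  rcases i with i | i
  · exact ((hl i).mul zero_le_one (by positivity) hG (((hl i).const_mul 2).add
      (C2Bound.const hG (-1)))).mono hG (by norm_num)
  · exact (((hl _).mul zero_le_one zero_le_one hG (hl _)).const_mul 4).mono hG (by norm_num)

/-- A product of three barycentric coordinates costs 4 · 4 = 16, and the barycenter function, with
27 · 16 = 432, is the worst. -/
theorem c2Bound_hermiteShape {t : Tri} {c : Plane} {r : ℝ} (hr : 0 < r)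
    (hb : Metric.ball c r ⊆ t.interior)
    (i : Fin 3 ⊕ Unit ⊕ {p : Fin 3 × Fin 3 // p.1 ≠ p.2}) :
    C2Bound t.closedInterior (2 / r) 432 (hermiteShape t i) := by
  have hG : 0 ≤ 2 / r := by positivity
  have hl := c2Bound_bary hr hb
  have h3 : ∀ i j k, C2Bound t.closedInterior (2 / r) 16
      (fun x => bary t i x * bary t j x * bary t k x) := fun i j k =>
    (((hl i).mul zero_le_one zero_le_one hG (hl j)).mul (by norm_num) zero_le_one hG
      (hl k)).mono hG (by norm_num)
  rcases i with i | _ | p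
  · exact ((((hl i).mul zero_le_one zero_le_one hG (hl i)).mul (by norm_num) (by positivity) hG
      (((hl i).const_mul (-2)).add (C2Bound.const hG 3))).sub ((h3 0 1 2).const_mul 7)).mono hG
      (by norm_num)
  · exact ((h3 0 1 2).const_mul 27).mono hG (by norm_num)
  · exact ((h3 _ _ _).sub (h3 0 1 2)).mono hG (by norm_num)

theorem midpoint_mem (t : Tri) (i j : Fin 3) :
    midpoint ℝ (t.points i) (t.points j) ∈ t.closedInterior :=
  (convex_closedInterior t).midpoint_mem (t.point_mem_closedInterior i)
    (t.point_mem_closedInterior j)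

theorem centroid_mem (t : Tri) : Finset.univ.centroid ℝ t.points ∈ t.closedInterior := by
  rw [mem_closedInterior_iff]
  intro i
  rw [affine_centroid]
  have h := fun j => (mem_closedInterior_iff t _).1 (t.point_mem_closedInterior j) i
  have h0 := h 0
  have h1 := h 1
  have h2 := h 2
  positivity

theorem abs_lagrangeNodal_le {t : Tri} {G c : ℝ} {v : Plane → ℝ}
    (hv : C2Bound t.closedInterior G c v) (i : Fin 3 ⊕ Fin 3) : |lagrangeNodal t i v| ≤ c := by
  obtain ⟨_, _, hv⟩ := hv
  rcases i with i | i
  · exact (hv _ (t.point_mem_closedInterior i)).2.2.1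
  · exact (hv _ (midpoint_mem t _ _)).2.2.1

/-- In the derivative variables the edge vector, no longer than the diameter, cancels the scale
1/diam of the gradient. This is why the Taylor remainder is bounded at that scale and not only at
2/r. -/
theorem abs_hermiteNodal_le {t : Tri} {c : ℝ} {v : Plane → ℝ} (hd : 0 < Metric.diam t.interior)
    (hv : C2Bound t.closedInterior (1 / Metric.diam t.interior) c v)
    (i : Fin 3 ⊕ Unit ⊕ {p : Fin 3 × Fin 3 // p.1 ≠ p.2}) : |hermiteNodal t i v| ≤ c := by
  obtain ⟨v₁, _, hv⟩ := hv
  rcases i with i | _ | p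
  · exact (hv _ (t.point_mem_closedInterior i)).2.2.1
  · exact (hv _ (centroid_mem t)).2.2.1
  · obtain ⟨h1, -, h0, h2, -⟩ := hv _ (t.point_mem_closedInterior p.1.1)
    have hc : 0 ≤ c := (abs_nonneg _).trans h0
    simp only [hermiteNodal]
    rw [h1.fderivWithin (uniqueDiffOn_closedInterior t _ (t.point_mem_closedInterior _)),
      ← Real.norm_eq_abs]
    calc _ ≤ ‖v₁ (t.points p.1.1)‖ * ‖t.points p.1.2 - t.points p.1.1‖ :=
          ContinuousLinearMap.le_opNorm _ _
      _ ≤ (c * (1 / Metric.diam t.interior)) * Metric.diam t.interior := by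
          gcongr
          exact dist_le_diam_interior t (t.point_mem_closedInterior _)
            (t.point_mem_closedInterior _)
      _ = c := by field_simp

/-- `u` is twice differentiable on `K`, and its second derivative has the Lipschitz constant `M`. -/
structure C21Bound (K : Set Plane) (M : ℝ) (u : Plane → ℝ)
    (u₁ : Plane → Plane →L[ℝ] ℝ) (u₂ : Plane → Plane →L[ℝ] Plane →L[ℝ] ℝ) : Prop where
  nonneg : 0 ≤ M
  hasFDeriv : ∀ x ∈ K, HasFDerivWithinAt u (u₁ x) K x
  hasFDeriv₂ : ∀ x ∈ K, HasFDerivWithinAt u₁ (u₂ x) K x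
  lipschitz : ∀ x ∈ K, ∀ y ∈ K, ‖u₂ x - u₂ y‖ ≤ M * ‖x - y‖
  symm : ∀ x ∈ K, ∀ v w, u₂ x v w = u₂ x w v

theorem exists_isPoly_approx {t : Tri} {K : Set Plane} {M : ℝ} {u : Plane → ℝ}
    {u₁ : Plane → Plane →L[ℝ] ℝ} {u₂ : Plane → Plane →L[ℝ] Plane →L[ℝ] ℝ}
    (hu : C21Bound K M u u₁ u₂) (ht : t.closedInterior ⊆ K) (hd : 0 < Metric.diam t.interior) :
    ∃ q, IsPoly 2 q ∧ (∀ x, DifferentiableAt ℝ q x) ∧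
      C2Bound t.closedInterior (1 / Metric.diam t.interior) (M * Metric.diam t.interior ^ 3)
        (fun x => u x - q x) := by
  have h0 := t.point_mem_closedInterior 0
  refine ⟨_, isPoly_taylor (u (t.points 0)) (u₁ (t.points 0)) (u₂ (t.points 0)) (t.points 0), ?_,
    c2Bound_taylor (convex_closedInterior t) hu.nonneg hd
    (fun x hx => (hu.hasFDeriv x (ht hx)).mono ht)
    (fun x hx => (hu.hasFDeriv₂ x (ht hx)).mono ht) h0
    (fun x hx => hu.lipschitz x (ht hx) _ (ht h0)) (hu.symm _ (ht h0))
    fun x hx => dist_le_diam_interior t hx h0⟩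
  intro x
  have hs : DifferentiableAt ℝ (fun y => y - t.points 0) x := differentiableAt_id.sub_const _
  exact (((u₁ _).differentiableAt.comp x hs).const_add _).add
    (DifferentiableAt.const_mul (((u₂ _).differentiableAt.comp x hs).clm_apply hs) _)

/-- A bound on the interpolation error on `t`, for a triangle that contains a ball of radius `r`. -/
def LocalErrorBound (loc : Tri → (Plane → ℝ) → Plane → ℝ) : Prop :=
  ∀ (t : Tri) (K : Set Plane) (M r : ℝ) (c : Plane) (u : Plane → ℝ)
    (u₁ : Plane → Plane →L[ℝ] ℝ) (u₂ : Plane → Plane →L[ℝ] Plane →L[ℝ] ℝ),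
    C21Bound K M u u₁ u₂ →
    t.closedInterior ⊆ K → 0 < r → Metric.ball c r ⊆ t.interior →
    C2Bound t.closedInterior (2 / r) (5000 * (M * Metric.diam t.interior ^ 3))
      (fun x => u x - loc t u x)

/-- With P₂ reproduced, the error is v - Σ Nᵢ(v) ψᵢ for the Taylor remainder v, and has the constant
(1 + card ι · B) M d³. The ten Hermite variables with B = 432 give the factor 4321, whence 5000. -/
theorem localErrorBound_of_nodal {ι : Type} [Fintype ι] {N : Tri → ι → (Plane → ℝ) → ℝ}
    {ψ : Tri → ι → Plane → ℝ} {loc : Tri → (Plane → ℝ) → Plane → ℝ} {B : ℝ} (hB : 0 ≤ B)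
    (hloc : ∀ t u x, loc t u x = ∑ i, N t i u * ψ t i x)
    (hq : ∀ t q, IsPoly 2 q → ∀ x, q x = ∑ i, N t i q * ψ t i x)
    (hN : ∀ t i q v, (∀ x ∈ t.closedInterior, DifferentiableWithinAt ℝ q t.closedInterior x) →
      (∀ x ∈ t.closedInterior, DifferentiableWithinAt ℝ v t.closedInterior x) →
      N t i (fun x => q x + v x) = N t i q + N t i v)
    (hNv : ∀ t i c v, 0 < Metric.diam t.interior →
      C2Bound t.closedInterior (1 / Metric.diam t.interior) c v → |N t i v| ≤ c)
    (hψ : ∀ (t : Tri) (c : Plane) (r : ℝ), 0 < r → Metric.ball c r ⊆ t.interior →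
      ∀ i, C2Bound t.closedInterior (2 / r) B (ψ t i))
    (hcard : 1 + Fintype.card ι * B ≤ 5000) : LocalErrorBound loc := by
  intro t K M r c u u₁ u₂ hu ht hr hb
  have hrd := half_radius_le_diam hr hb
  have hd : 0 < Metric.diam t.interior := by linarith
  obtain ⟨q, hq2, hqd, hv⟩ := exists_isPoly_approx hu ht hd
  have hM : 0 ≤ M := hu.nonneg
  have hG : 0 ≤ 2 / r := by positivity
  -- The nodal values of v are estimated at scale 1/d, but v is added to shape functions at the
  -- larger scale 2/r.
  have hv' : C2Bound t.closedInterior (2 / r) (M * Metric.diam t.interior ^ 3)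
      (fun x => u x - q x) := by
    refine hv.mono_scale (by positivity) (by positivity) ?_
    rw [div_le_div_iff₀ hd hr]
    linarith
  have hsplit : ∀ i, N t i u = N t i q + N t i (fun x => u x - q x) := by
    intro i
    rw [← hN t i q _ (fun x _ => (hqd x).differentiableWithinAt) ?_]
    · congr 1
      funext x
      ring
    · obtain ⟨v₁, v₂, hv⟩ := hv
      exact fun x hx => (hv x hx).1.differentiableWithinAt
  have h := c2Bound_interp_error hG hB (hq t q hq2) hsplit hv' (fun i => hNv t i _ _ hd hv)
    (hψ t c r hr hb)
  refine (h.congr fun x _ => by rw [hloc]).mono hG ?_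
  have : 0 ≤ M * Metric.diam t.interior ^ 3 := by positivity
  nlinarith

theorem lagrange_localErrorBound : LocalErrorBound lagrangeLocal := by
  refine localErrorBound_of_nodal (B := 16) (by norm_num) lagrangeLocal_eq lagrange_repr ?_
    (fun t i c v _ hv => abs_lagrangeNodal_le hv i) (fun t c r => c2Bound_lagrangeShape)
    (by norm_num [Fintype.card_sum])
  rintro t (i | i) q v - - <;> rfl

theorem hermite_localErrorBound : LocalErrorBound hermiteLocal := by
  refine localErrorBound_of_nodal (B := 432) (by norm_num) hermiteLocal_eq
    (fun t q hq => hermite_repr t q (hq.mono (by norm_num))) ?_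
    (fun t i c v hd hv => abs_hermiteNodal_le hd hv i) (fun t c r => c2Bound_hermiteShape) ?_
  · rintro t (i | _ | p) q v hq hv
    · rfl
    · rfl
    · have hz := t.point_mem_closedInterior p.1.1
      simp only [hermiteNodal]
      rw [fderivWithin_fun_add (uniqueDiffOn_closedInterior t _ hz) (hq _ hz) (hv _ hz)]
      rfl
  · have : Fintype.card {p : Fin 3 × Fin 3 // p.1 ≠ p.2} = 6 := by decide
    rw [Fintype.card_sum, Fintype.card_sum, this]
    norm_num

/-! ### Traces on edges -/

theorem bary_lineMap (t : Tri) (i j k : Fin 3) (τ : ℝ) :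
    bary t k (AffineMap.lineMap (t.points i) (t.points j) τ) =
      (1 - τ) * (if k = i then 1 else 0) + τ * (if k = j then 1 else 0) := by
  rw [(bary t k).apply_lineMap, AffineMap.lineMap_apply_ring', bary_point, bary_point]
  ring

/-- The third barycentric coordinate vanishes on the edge, and with it every shape function except
those of the endpoints and the midpoint. -/
theorem lagrangeLocal_lineMap (t : Tri) (u : Plane → ℝ) {i j : Fin 3} (hij : i ≠ j) (τ : ℝ) :
    lagrangeLocal t u (AffineMap.lineMap (t.points i) (t.points j) τ) =
      u (t.points i) * ((1 - τ) * (1 - 2 * τ)) + u (t.points j) * (τ * (2 * τ - 1)) +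
        u (midpoint ℝ (t.points i) (t.points j)) * (4 * τ * (1 - τ)) := by
  rw [lagrangeLocal_eq, Fintype.sum_sum_type]
  simp only [lagrangeNodal, lagrangeShape, bary_lineMap, Fin.sum_univ_three]
  have e0 := midpoint_comm (R := ℝ) (t.points 0) (t.points 1)
  have e1 := midpoint_comm (R := ℝ) (t.points 1) (t.points 2)
  have e2 := midpoint_comm (R := ℝ) (t.points 0) (t.points 2)
  fin_cases i <;> fin_cases j <;> simp at hij ⊢ <;>
    (try simp only [e0, e1, e2]) <;> ring

/-- Terms containing the third barycentric coordinate vanish; what remains is one-dimensional cubic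
Hermite interpolation with tangential derivatives at the endpoints. -/
theorem hermiteLocal_lineMap (t : Tri) (u : Plane → ℝ) {i j : Fin 3} (hij : i ≠ j) (τ : ℝ) :
    hermiteLocal t u (AffineMap.lineMap (t.points i) (t.points j) τ) =
      u (t.points i) * ((1 - τ) ^ 2 * (1 + 2 * τ)) + u (t.points j) * (τ ^ 2 * (3 - 2 * τ)) +
      fderivWithin ℝ u t.closedInterior (t.points i) (t.points j - t.points i) *
        ((1 - τ) ^ 2 * τ) +
      fderivWithin ℝ u t.closedInterior (t.points j) (t.points i - t.points j) *
        (τ ^ 2 * (1 - τ)) := by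
  rw [hermiteLocal_eq, Fintype.sum_sum_type, Fintype.sum_sum_type]
  simp only [hermiteNodal, hermiteShape, bary_lineMap, Fin.sum_univ_three, Finset.univ_unique,
    Finset.sum_singleton]
  rw [sum_offDiag (fun p => fderivWithin ℝ u t.closedInterior (t.points p.1)
    (t.points p.2 - t.points p.1) * (((1 - τ) * (if p.1 = i then 1 else 0) +
      τ * (if p.1 = j then 1 else 0)) * ((1 - τ) * (if p.1 = i then 1 else 0) +
      τ * (if p.1 = j then 1 else 0)) * ((1 - τ) * (if p.2 = i then 1 else 0) +
      τ * (if p.2 = j then 1 else 0)) - ((1 - τ) * (if 0 = i then 1 else 0) +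
      τ * (if 0 = j then 1 else 0)) * ((1 - τ) * (if 1 = i then 1 else 0) +
      τ * (if 1 = j then 1 else 0)) * ((1 - τ) * (if 2 = i then 1 else 0) +
      τ * (if 2 = j then 1 else 0))))]
  fin_cases i <;> fin_cases j <;> simp at hij ⊢ <;> ring

/-! ### Common faces of the triangles of a triangulation -/

/-- If e and v had nonzero determinant, Cramer's rule would force f = 0. The coefficient is that of
the orthogonal projection of v on e. -/
theorem exists_smul_of_clm_eq_zero {f : Plane →L[ℝ] ℝ} (hf : f ≠ 0) {e v : Plane} (he : e ≠ 0)
    (hfe : f e = 0) (hfv : f v = 0) : ∃ γ : ℝ, v = γ • e := by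
  set p := f (EuclideanSpace.single 0 1)
  set q := f (EuclideanSpace.single 1 1)
  have hform : ∀ w : Plane, f w = w 0 * p + w 1 * q := fun w => by
    conv_lhs => rw [plane_eq_sum w]
    simp [p, q]
  rw [hform] at hfe hfv
  have hdet : v 0 * e 1 = v 1 * e 0 := by
    by_contra hne
    have hne' : v 0 * e 1 - v 1 * e 0 ≠ 0 := sub_ne_zero.2 hne
    have hp : p = 0 := by
      refine (mul_eq_zero.1 (?_ : (v 0 * e 1 - v 1 * e 0) * p = 0)).resolve_left hne'
      linear_combination e 1 * hfv - v 1 * hfe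
    have hq : q = 0 := by
      refine (mul_eq_zero.1 (?_ : (v 0 * e 1 - v 1 * e 0) * q = 0)).resolve_left hne'
      linear_combination v 0 * hfe - e 0 * hfv
    exact hf (by ext w; simp [hform, hp, hq])
  have hpos : e 0 ^ 2 + e 1 ^ 2 ≠ 0 := by
    intro h
    have h0 : e 0 = 0 := by nlinarith [sq_nonneg (e 0), sq_nonneg (e 1)]
    have h1 : e 1 = 0 := by nlinarith [sq_nonneg (e 0), sq_nonneg (e 1)]
    exact he (by ext i; fin_cases i <;> simp [h0, h1])
  refine ⟨(v 0 * e 0 + v 1 * e 1) / (e 0 ^ 2 + e 1 ^ 2), ?_⟩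
  ext i
  fin_cases i
  · simp only [Fin.zero_eta, PiLp.smul_apply, smul_eq_mul]
    field_simp
    linear_combination e 1 * hdet
  · simp only [Fin.mk_one, PiLp.smul_apply, smul_eq_mul]
    field_simp
    linear_combination -e 0 * hdet

/-- Two collinear segments whose relative interiors meet and do not contain the end points of the other
segment coincide. -/
theorem segments_eq {f : Plane →L[ℝ] ℝ} (hf : f ≠ 0) {a b c d x : Plane} (hab : a ≠ b)
    (hfb : f b = f a) (hfc : f c = f a) (hfd : f d = f a)
    (hx : x ∈ openSegment ℝ a b) (hx' : x ∈ openSegment ℝ c d)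
    (ha : a ∉ openSegment ℝ c d) (hb : b ∉ openSegment ℝ c d)
    (hc : c ∉ openSegment ℝ a b) (hd : d ∉ openSegment ℝ a b) :
    (a = c ∧ b = d) ∨ (a = d ∧ b = c) := by
  have he : b - a ≠ 0 := sub_ne_zero.2 hab.symm
  have hline : ∀ y, f y = f a → ∃ γ : ℝ, y = AffineMap.lineMap a b γ := by
    intro y hy
    obtain ⟨γ, hγ⟩ := exists_smul_of_clm_eq_zero hf (v := y - a) he
      (by rw [map_sub, hfb, sub_self]) (by rw [map_sub, hy, sub_self])
    exact ⟨γ, by rw [AffineMap.lineMap_apply_module', ← hγ]; abel⟩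
  have hinj : ∀ s t : ℝ, (AffineMap.lineMap a b s : Plane) = AffineMap.lineMap a b t ↔ s = t :=
    fun s t => (AffineMap.lineMap_injective ℝ hab).eq_iff
  -- All points are parametrised on the line with a at 0 and b at 1; the claim becomes {γ, δ} = {0,
  -- 1}.
  obtain ⟨γ, rfl⟩ := hline c hfc
  obtain ⟨δ, rfl⟩ := hline d hfd
  have hcomb : ∀ σ : ℝ, (AffineMap.lineMap (AffineMap.lineMap a b γ : Plane)
      (AffineMap.lineMap a b δ : Plane) σ : Plane) =
      AffineMap.lineMap a b ((1 - σ) * γ + σ * δ) := by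
    intro σ
    simp only [AffineMap.lineMap_apply_module']
    module
  have h0 : (AffineMap.lineMap a b (0 : ℝ) : Plane) = a := AffineMap.lineMap_apply_zero a b
  have h1 : (AffineMap.lineMap a b (1 : ℝ) : Plane) = b := AffineMap.lineMap_apply_one a b
  rw [openSegment_eq_image_lineMap] at hx hx' ha hb hc hd
  obtain ⟨τ, ⟨hτ0, hτ1⟩, rfl⟩ := hx
  obtain ⟨σ, ⟨hσ0, hσ1⟩, hσ⟩ := hx'
  rw [hcomb, hinj] at hσ
  have hmem : ∀ θ : ℝ, (γ < θ ∧ θ < δ) ∨ (δ < θ ∧ θ < γ) →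
      (AffineMap.lineMap a b θ : Plane) ∈ (AffineMap.lineMap (AffineMap.lineMap a b γ : Plane)
      (AffineMap.lineMap a b δ : Plane)) '' Set.Ioo (0 : ℝ) 1 := by
    intro θ hθ
    have hne : δ - γ ≠ 0 := by
      rcases hθ with h | h
      · exact (by linarith : (0 : ℝ) < δ - γ).ne'
      · exact (by linarith : δ - γ < 0).ne
    refine ⟨(θ - γ) / (δ - γ), ?_, ?_⟩
    · rcases hθ with h | h
      · exact ⟨div_pos (by linarith) (by linarith), by
          rw [div_lt_one (by linarith)]; linarith⟩
      · exact ⟨div_pos_of_neg_of_neg (by linarith) (by linarith), by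
          rw [div_lt_one_of_neg (by linarith)]; linarith⟩
    · rw [hcomb, hinj]
      field_simp
      ring
  have ha' : ¬((γ < 0 ∧ 0 < δ) ∨ (δ < 0 ∧ 0 < γ)) := fun h => ha (by
    have := hmem 0 h; rwa [h0] at this)
  have hb' : ¬((γ < 1 ∧ 1 < δ) ∨ (δ < 1 ∧ 1 < γ)) := fun h => hb (by
    have := hmem 1 h; rwa [h1] at this)
  have hc' : ¬(0 < γ ∧ γ < 1) := fun h => hc ⟨γ, h, rfl⟩
  have hd' : ¬(0 < δ ∧ δ < 1) := fun h => hd ⟨δ, h, rfl⟩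
  -- The open interval between γ and δ meets (0, 1) at τ, and neither interval contains an endpoint
  -- of the other, so they are equal.
  rcases lt_trichotomy γ δ with hlt | heq | hgt
  · have h2 : γ < τ := by nlinarith
    have h3 : τ < δ := by nlinarith
    have h4 : γ = 0 := by
      refine le_antisymm ?_ ?_
      · by_contra h; exact hc' ⟨not_le.1 h, by linarith⟩
      · by_contra h; exact ha' (Or.inl ⟨not_le.1 h, by linarith⟩)
    have h5 : δ = 1 := by
      refine le_antisymm ?_ ?_
      · by_contra h; exact hb' (Or.inl ⟨by linarith, not_le.1 h⟩)
      · by_contra h; exact hd' ⟨by linarith, not_le.1 h⟩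
    left
    rw [h4, h5, h0, h1]
    exact ⟨rfl, rfl⟩
  · exfalso
    subst heq
    have : γ = τ := by linarith
    exact hc' (by rw [this]; exact ⟨hτ0, hτ1⟩)
  · have h2 : δ < τ := by nlinarith
    have h3 : τ < γ := by nlinarith
    have h4 : δ = 0 := by
      refine le_antisymm ?_ ?_
      · by_contra h; exact hd' ⟨not_le.1 h, by linarith⟩
      · by_contra h; exact ha' (Or.inr ⟨not_le.1 h, by linarith⟩)
    have h5 : γ = 1 := by
      refine le_antisymm ?_ ?_
      · by_contra h; exact hb' (Or.inr ⟨by linarith, not_le.1 h⟩)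
      · by_contra h; exact hc' ⟨by linarith, not_le.1 h⟩
    right
    rw [h4, h5, h0, h1]
    exact ⟨rfl, rfl⟩

/-- A point of a triangle on a supporting line is a vertex, or in the relative interior of an edge,
on the line. -/
theorem mem_face_of_supporting (t : Tri) {f : Plane →L[ℝ] ℝ} {c : ℝ}
    (hf : ∀ y ∈ t.interior, f y < c) {x : Plane} (hx : x ∈ t.closedInterior) (hfx : f x = c) :
    (∃ i, x = t.points i) ∨ ∃ i j, i ≠ j ∧ x ∈ openSegment ℝ (t.points i) (t.points j) ∧
      f (t.points i) = c ∧ f (t.points j) = c := by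
  have hle : ∀ y ∈ t.closedInterior, f y ≤ c := by
    rw [← closure_interior]
    intro y hy
    exact closure_minimal (fun z hz => (hf z hz).le) (isClosed_le f.continuous continuous_const) hy
  have hb := (mem_closedInterior_iff t x).1 hx
  have hxi : x ∉ t.interior := fun h => (hf x h).ne hfx
  rw [mem_interior_iff] at hxi
  push Not at hxi
  obtain ⟨k, hk⟩ := hxi
  have hk0 : bary t k x = 0 := le_antisymm hk (hb k)
  have hsum := sum_bary t x
  have hxs := sum_bary_smul t x
  have key : ∀ i j, i ≠ j → bary t i x + bary t j x = 1 →
      bary t i x • t.points i + bary t j x • t.points j = x →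
      (∃ i, x = t.points i) ∨ ∃ i j, i ≠ j ∧ x ∈ openSegment ℝ (t.points i) (t.points j) ∧
      f (t.points i) = c ∧ f (t.points j) = c := by
    intro i j hij h1 h2
    rcases (hb i).eq_or_lt with hi | hi
    · left
      refine ⟨j, ?_⟩
      rw [← hi, zero_add] at h1
      rw [← hi, h1, zero_smul, one_smul, zero_add] at h2
      exact h2.symm
    rcases (hb j).eq_or_lt with hj | hj
    · left
      refine ⟨i, ?_⟩
      rw [← hj, add_zero] at h1
      rw [← hj, h1, zero_smul, one_smul, add_zero] at h2
      exact h2.symm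
    right
    have h3 := congrArg f h2
    rw [map_add, map_smul, map_smul, smul_eq_mul, smul_eq_mul, hfx] at h3
    have li := hle _ (t.point_mem_closedInterior i)
    have lj := hle _ (t.point_mem_closedInterior j)
    -- c is a convex combination, with positive weights, of two values that are at most c, so both
    -- equal c.
    have h4 : bary t i x * (c - f (t.points i)) + bary t j x * (c - f (t.points j)) = 0 := by
      linear_combination c * h1 - h3
    have p1 := mul_nonneg hi.le (sub_nonneg.2 li)
    have p2 := mul_nonneg hj.le (sub_nonneg.2 lj)
    have q1 := (mul_eq_zero.1 (by linarith : bary t i x * (c - f (t.points i)) = 0)).resolve_left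
      hi.ne'
    have q2 := (mul_eq_zero.1 (by linarith : bary t j x * (c - f (t.points j)) = 0)).resolve_left
      hj.ne'
    exact ⟨i, j, hij, ⟨_, _, hi, hj, h1, h2⟩, by linarith, by linarith⟩
  rw [Fin.sum_univ_three] at hsum hxs
  obtain rfl | rfl | rfl : k = 0 ∨ k = 1 ∨ k = 2 := by fin_cases k <;> simp
  · exact key 1 2 (by decide) (by simpa [hk0] using hsum) (by simpa [hk0] using hxs)
  · exact key 0 2 (by decide) (by simpa [hk0] using hsum) (by simpa [hk0] using hxs)
  · exact key 0 1 (by decide) (by simpa [hk0] using hsum) (by simpa [hk0] using hxs)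

/-- A line separates the two open triangles, and a common point of the closures lies on it, hence at
a vertex or inside an edge of each triangle on that line. Conformity excludes a vertex inside an
edge, and two open edges that meet coincide by `segments_eq`. -/
theorem IsTriangulation.common_face {Ω : Set Plane} {𝒯 : Finset Tri} (h : IsTriangulation Ω 𝒯)
    {s t : Tri} (hs : s ∈ 𝒯) (ht : t ∈ 𝒯) (hst : s ≠ t) {x : Plane} (hxs : x ∈ s.closedInterior)
    (hxt : x ∈ t.closedInterior) :
    (∃ i j, s.points i = t.points j ∧ x = s.points i) ∨
      ∃ i j k l, i ≠ j ∧ k ≠ l ∧ s.points i = t.points k ∧ s.points j = t.points l ∧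
        ∃ τ : ℝ, x = AffineMap.lineMap (s.points i) (s.points j) τ := by
  obtain ⟨f, c, hfs, hft⟩ := geometric_hahn_banach_open_open (convex_interior s) (isOpen_interior s)
    (convex_interior t) (isOpen_interior t) (h.disjoint s hs t ht hst)
  have hf0 : f ≠ 0 := by
    rintro rfl
    obtain ⟨y, hy⟩ := nonempty_interior s
    obtain ⟨z, hz⟩ := nonempty_interior t
    exact lt_asymm (hfs y hy) (hft z hz)
  have h1 : f x ≤ c := by
    rw [← closure_interior] at hxs
    exact closure_minimal (fun z hz => (hfs z hz).le) (isClosed_le f.continuous continuous_const)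
      hxs
  have h2 : c ≤ f x := by
    rw [← closure_interior] at hxt
    exact closure_minimal (fun z hz => (hft z hz).le) (isClosed_le continuous_const f.continuous)
      hxt
  have hx : f x = c := le_antisymm h1 h2
  have hs' := mem_face_of_supporting s hfs hxs hx
  have ht' := mem_face_of_supporting t (f := -f) (c := -c)
    (fun y hy => by simpa using hft y hy) hxt (by simpa using hx)
  rcases hs' with ⟨i, hi⟩ | ⟨i, j, hij, hxij, hi, hj⟩
  · rcases ht' with ⟨k, hk⟩ | ⟨k, l, hkl, hxkl, hk, hl⟩
    · exact Or.inl ⟨i, k, hi.symm.trans hk, hi⟩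
    · exact absurd (hi ▸ hxkl) (h.conforming s hs t ht hst i k l hkl)
  · rcases ht' with ⟨k, hk⟩ | ⟨k, l, hkl, hxkl, hk, hl⟩
    · exact absurd (hk ▸ hxij) (h.conforming t ht s hs hst.symm k i j hij)
    · have hk' : f (t.points k) = c := by simpa using hk
      have hl' : f (t.points l) = c := by simpa using hl
      have hτ : ∃ τ : ℝ, x = AffineMap.lineMap (s.points i) (s.points j) τ := by
        rw [openSegment_eq_image_lineMap] at hxij
        obtain ⟨τ, -, hτ⟩ := hxij
        exact ⟨τ, hτ.symm⟩
      right
      rcases segments_eq hf0 (s.independent.injective.ne hij) (hj.trans hi.symm)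
        (hk'.trans hi.symm) (hl'.trans hi.symm) hxij hxkl
        (h.conforming s hs t ht hst i k l hkl) (h.conforming s hs t ht hst j k l hkl)
        (h.conforming t ht s hs hst.symm k i j hij)
        (h.conforming t ht s hs hst.symm l i j hij) with ⟨e1, e2⟩ | ⟨e1, e2⟩
      · exact ⟨i, j, k, l, hij, hkl, e1, e2, hτ⟩
      · exact ⟨i, j, l, k, hij, hkl.symm, e1, e2, hτ⟩

/-- The local interpolants of two triangles of a triangulation agree on the common points. -/
def Compatible (loc : Tri → (Plane → ℝ) → Plane → ℝ) (𝒯 : Finset Tri) (u : Plane → ℝ) : Prop :=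
  ∀ s ∈ 𝒯, ∀ t ∈ 𝒯, ∀ x ∈ s.closedInterior, x ∈ t.closedInterior → loc s u x = loc t u x

/-- Φ expresses the trace through the endpoints of the edge alone, so it is the same from both
sides; τ = 0 settles common vertices. -/
theorem compatible_of_trace {loc : Tri → (Plane → ℝ) → Plane → ℝ} {Ω : Set Plane}
    {𝒯 : Finset Tri} (h : IsTriangulation Ω 𝒯) {u : Plane → ℝ} (Φ : Plane → Plane → ℝ → ℝ)
    (hloc : ∀ t ∈ 𝒯, ∀ i j, i ≠ j → ∀ τ : ℝ,
      loc t u (AffineMap.lineMap (t.points i) (t.points j) τ) = Φ (t.points i) (t.points j) τ)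
    (hΦ : ∀ a b, Φ a b 0 = u a) : Compatible loc 𝒯 u := by
  have hv : ∀ t ∈ 𝒯, ∀ i, loc t u (t.points i) = u (t.points i) := by
    intro t ht i
    have := hloc t ht i (i + 1) (by fin_cases i <;> decide) 0
    rwa [AffineMap.lineMap_apply_zero, hΦ] at this
  intro s hs t ht x hxs hxt
  rcases eq_or_ne s t with rfl | hst
  · rfl
  rcases h.common_face hs ht hst hxs hxt with ⟨i, j, hij, rfl⟩ |
    ⟨i, j, k, l, hij, hkl, e1, e2, τ, rfl⟩
  · rw [hv s hs, hij, hv t ht]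
  · rw [hloc s hs i j hij, e1, e2, hloc t ht k l hkl]

theorem closedInterior_subset_closure {Ω : Set Plane} {𝒯 : Finset Tri} (h : IsTriangulation Ω 𝒯)
    {t : Tri} (ht : t ∈ 𝒯) : t.closedInterior ⊆ closure Ω := by
  rw [← h.cover]
  exact Set.subset_biUnion_of_mem (u := fun t : Tri => t.closedInterior) ht

theorem lagrange_compatible {Ω : Set Plane} {𝒯 : Finset Tri} (h : IsTriangulation Ω 𝒯)
    (u : Plane → ℝ) : Compatible lagrangeLocal 𝒯 u :=
  compatible_of_trace h (fun a b τ => u a * ((1 - τ) * (1 - 2 * τ)) + u b * (τ * (2 * τ - 1)) +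
      u (midpoint ℝ a b) * (4 * τ * (1 - τ)))
    (fun t _ _ _ hij τ => lagrangeLocal_lineMap t u hij τ) (fun a b => by ring)

/-- The derivative within a triangle at a vertex equals the derivative within closure Ω, which does
not depend on the triangle. -/
theorem hermite_compatible {Ω : Set Plane} {𝒯 : Finset Tri} (h : IsTriangulation Ω 𝒯)
    {u : Plane → ℝ} (hu : DifferentiableOn ℝ u (closure Ω)) : Compatible hermiteLocal 𝒯 u := by
  refine compatible_of_trace h (fun a b τ => u a * ((1 - τ) ^ 2 * (1 + 2 * τ)) +
      u b * (τ ^ 2 * (3 - 2 * τ)) +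
      fderivWithin ℝ u (closure Ω) a (b - a) * ((1 - τ) ^ 2 * τ) +
      fderivWithin ℝ u (closure Ω) b (a - b) * (τ ^ 2 * (1 - τ))) ?_ (fun a b => by ring)
  intro t ht i j hij τ
  have hD : ∀ i, fderivWithin ℝ u t.closedInterior (t.points i) =
      fderivWithin ℝ u (closure Ω) (t.points i) := fun i =>
    fderivWithin_subset (closedInterior_subset_closure h ht)
      (uniqueDiffOn_closedInterior t _ (t.point_mem_closedInterior i))
      (hu _ (closedInterior_subset_closure h ht (t.point_mem_closedInterior i)))
  rw [hermiteLocal_lineMap t u hij, hD, hD]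

theorem globalInterp_eq {loc : Tri → (Plane → ℝ) → Plane → ℝ} {𝒯 : Finset Tri} {u : Plane → ℝ}
    (h : Compatible loc 𝒯 u) {t : Tri} (ht : t ∈ 𝒯) {x : Plane} (hx : x ∈ t.closedInterior) :
    globalInterp loc 𝒯 u x = loc t u x := by
  have he : ∃ t ∈ 𝒯, x ∈ t.closedInterior := ⟨t, ht, hx⟩
  rw [globalInterp, dif_pos he]
  exact h _ he.choose_spec.1 _ ht x he.choose_spec.2 hx

/-! ### Lipschitz functions on finite unions -/

/-- A function that is Lipschitz on each of finitely many closed sets with convex union is Lipschitz on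
the union. -/
theorem lipschitzOnWith_biUnion {E ι : Type*} [NormedAddCommGroup E] [NormedSpace ℝ E]
    {s : Finset ι} {A : ι → Set E} {f : E → ℝ} {L : ℝ≥0} (hA : ∀ i ∈ s, IsClosed (A i))
    (hconv : Convex ℝ (⋃ i ∈ s, A i)) (hf : ∀ i ∈ s, LipschitzOnWith L f (A i)) :
    LipschitzOnWith L f (⋃ i ∈ s, A i) := by
  have hcont : ContinuousOn f (⋃ i ∈ s, A i) := by
    have h := (locallyFinite_of_finite fun i : s => A i).continuousOn_iUnion
      (fun i => hA i i.2) (fun i => (hf i i.2).continuousOn)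
    rwa [Set.iUnion_subtype (fun i => i ∈ s) (fun i => A i)] at h
  have key : ∀ x ∈ ⋃ i ∈ s, A i, ∀ y ∈ ⋃ i ∈ s, A i, f y - f x ≤ L * ‖y - x‖ := by
    intro x hx y hy
    set p : ℝ → E := fun τ => AffineMap.lineMap x y τ with hp
    have hpc : Continuous p := AffineMap.lineMap_continuous
    have hpmem : ∀ τ ∈ Set.Icc (0 : ℝ) 1, p τ ∈ ⋃ i ∈ s, A i := fun τ hτ =>
      hconv.lineMap_mem hx hy hτ
    have hpd : ∀ σ τ, ‖p τ - p σ‖ = |τ - σ| * ‖y - x‖ := by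
      intro σ τ
      rw [← Real.norm_eq_abs, ← norm_smul]
      simp only [hp, AffineMap.lineMap_apply_module']
      congr 1
      module
    -- This mean value inequality asks at each τ only for points z > τ arbitrarily near τ with slope
    -- below r. As finitely many sets cover the segment, some A i contains p z for such z; being
    -- closed it contains p τ, and the Lipschitz bound on A i applies.
    have h := image_le_of_liminf_slope_right_le_deriv_boundary (a := 0) (b := 1)
      (f := fun τ => f (p τ)) (B := fun τ => f x + L * ‖y - x‖ * τ)
      (B' := fun _ => L * ‖y - x‖)
      (hcont.comp hpc.continuousOn hpmem) (by simp [hp]) (by fun_prop)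
      (fun τ _ => by
        simpa using (((hasDerivAt_id τ).const_mul (L * ‖y - x‖)).const_add (f x)).hasDerivWithinAt)
      (fun τ hτ r hr => ?_) (Set.right_mem_Icc.2 zero_le_one)
    · simp only [hp, AffineMap.lineMap_apply_one, mul_one] at h
      linarith
    · rw [Filter.Frequently]
      intro hev
      have hno : ∀ i ∈ s, ∀ᶠ z in 𝓝[>] τ, p z ∉ A i := by
        intro i hi
        by_contra hfr
        have hfr' : ∃ᶠ z in 𝓝[>] τ, p z ∈ A i := hfr
        have hmem : p τ ∈ A i := by
          have : p τ ∈ closure (A i) := by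
            rw [mem_closure_iff_frequently]
            exact (hpc.tendsto τ |>.mono_left nhdsWithin_le_nhds).frequently hfr'
          rwa [(hA i hi).closure_eq] at this
        obtain ⟨z, ⟨hz, hz'⟩, hzτ⟩ := ((hfr'.and_eventually hev).and_eventually
          self_mem_nhdsWithin).exists
        have hzτ' : 0 < z - τ := sub_pos.2 hzτ
        apply hz'
        have h1 := (hf i hi).dist_le_mul _ hz _ hmem
        rw [dist_eq_norm, dist_eq_norm, hpd, abs_of_pos hzτ', Real.norm_eq_abs] at h1
        rw [slope_def_field, div_lt_iff₀ hzτ']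
        calc f (p z) - f (p τ) ≤ L * ((z - τ) * ‖y - x‖) := (le_abs_self _).trans h1
          _ = L * ‖y - x‖ * (z - τ) := by ring
          _ < r * (z - τ) := mul_lt_mul_of_pos_right hr hzτ'
      have hall : ∀ᶠ z in 𝓝[>] τ, ∀ i ∈ s, p z ∉ A i := (Filter.eventually_all_finset s).2 hno
      have h1 : ∀ᶠ z in 𝓝[>] τ, z ∈ Set.Ioo τ 1 := Ioo_mem_nhdsGT hτ.2
      obtain ⟨z, hz, hz1⟩ := (hall.and h1).exists
      have := hpmem z ⟨hτ.1.trans hz1.1.le, hz1.2.le⟩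
      simp only [Set.mem_iUnion] at this
      obtain ⟨i, hi, hzi⟩ := this
      exact hz i hi hzi
  refine LipschitzOnWith.of_le_add_mul L fun y hy x hx => ?_
  have := key x hx y hy
  rw [dist_eq_norm]
  linarith

/-- A bounded Lipschitz function on a set has a Lipschitz extension with the same bound. -/
theorem exists_bounded_extension {E : Type*} [NormedAddCommGroup E] {K : Set E} {V : E → ℝ}
    {L : ℝ≥0} {S : ℝ} (hS : 0 ≤ S) (hV : LipschitzOnWith L V K) (hVS : ∀ x ∈ K, |V x| ≤ S) :
    ∃ W : E → ℝ, LipschitzWith L W ∧ (∀ x, |W x| ≤ S) ∧ Set.EqOn V W K := by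
  obtain ⟨W, hW, hVW⟩ := hV.extend_real
  refine ⟨fun x => max (-S) (min S (W x)), (hW.const_min S).const_max (-S), fun x => ?_,
    fun x hx => ?_⟩
  · rw [abs_le]
    exact ⟨le_max_left _ _, max_le (by linarith) (min_le_left _ _)⟩
  · have := abs_le.1 (hVS x hx)
    rw [hVW hx] at this
    simp only [hVW hx]
    rw [min_eq_right this.2, max_eq_right this.1]

/-! ### A divergence theorem for convex sets, as an inequality -/

/-- x + w is the image of the convex combination of x and c + w/s with weights 1/(1+s) and s/(1+s),
and c + w/s lies in the ball. -/
theorem subset_homothety {K : Set Plane} (hK : Convex ℝ K) {c : Plane} {r : ℝ}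
    (hb : Metric.ball c r ⊆ K) {s : ℝ} (hs : 0 < s) {w : Plane} (hw : ‖w‖ < s * r) {x : Plane}
    (hx : x ∈ K) : x + w ∈ AffineMap.homothety c (1 + s) '' K := by
  have h1 : (0 : ℝ) < 1 + s := by linarith
  have hmem : c + s⁻¹ • w ∈ K := by
    apply hb
    rw [Metric.mem_ball, dist_eq_norm, add_sub_cancel_left, norm_smul, Real.norm_eq_abs,
      abs_of_pos (inv_pos.2 hs), inv_mul_lt_iff₀ hs]
    exact hw
  refine ⟨(1 / (1 + s)) • x + (s / (1 + s)) • (c + s⁻¹ • w),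
    hK hx hmem (by positivity) (by positivity) (by field_simp), ?_⟩
  rw [AffineMap.homothety_apply, vsub_eq_sub, vadd_eq_add]
  have e1 : (1 + s) * (1 / (1 + s)) = 1 := by field_simp
  have e2 : (1 + s) * (s / (1 + s)) = s := by field_simp
  rw [smul_sub, smul_add, smul_smul, smul_smul, e1, e2, smul_add, smul_smul,
    mul_inv_cancel₀ hs.ne']
  module

/-- K and K + w both lie in the dilate K₂, of area (1+s)²|K|, so their symmetric difference is
covered by K₂ \ K and K₂ \ (K + w). -/
theorem integral_abs_indicator_sub_le {K : Set Plane} (hK : Convex ℝ K) (hKo : IsOpen K)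
    (hKb : Bornology.IsBounded K) {c : Plane} {r : ℝ} (hr : 0 < r) (hb : Metric.ball c r ⊆ K)
    {s : ℝ} (hs : 0 < s) {w : Plane} (hw : ‖w‖ < s * r) :
    ∫ y, |K.indicator (1 : Plane → ℝ) (y - w) - K.indicator (1 : Plane → ℝ) y| ≤
      2 * ((1 + s) ^ 2 - 1) * volume.real K := by
  set K₂ := AffineMap.homothety c (1 + s) '' K with hK₂
  have hK₂o : IsOpen K₂ := AffineMap.homothety_isOpenMap c (1 + s) (by linarith) _ hKo
  have hvol : volume K₂ = ENNReal.ofReal ((1 + s) ^ 2) * volume K := by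
    rw [hK₂, Measure.addHaar_image_homothety, finrank_euclideanSpace_fin,
      abs_of_nonneg (by positivity)]
  have hKfin : volume K ≠ ⊤ := hKb.measure_lt_top.ne
  have hK₂fin : volume K₂ ≠ ⊤ := by
    rw [hvol]; exact ENNReal.mul_ne_top ENNReal.ofReal_ne_top hKfin
  have hreal : volume.real K₂ = (1 + s) ^ 2 * volume.real K := by
    rw [Measure.real, hvol, ENNReal.toReal_mul, ENNReal.toReal_ofReal (by positivity), Measure.real]
  have i1 : Integrable (K.indicator (1 : Plane → ℝ)) :=
    (integrable_indicator_iff hKo.measurableSet).2 (integrableOn_const (C := (1 : ℝ)) hKfin)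
  have i2 : Integrable (K₂.indicator (1 : Plane → ℝ)) :=
    (integrable_indicator_iff hK₂o.measurableSet).2 (integrableOn_const (C := (1 : ℝ)) hK₂fin)
  have i3 : Integrable (fun y => K.indicator (1 : Plane → ℝ) (y - w)) := i1.comp_sub_right w
  have e1 : ∫ y, K.indicator (1 : Plane → ℝ) y = volume.real K :=
    integral_indicator_one hKo.measurableSet
  have e2 : ∫ y, K₂.indicator (1 : Plane → ℝ) y = volume.real K₂ :=
    integral_indicator_one hK₂o.measurableSet
  have e3 : ∫ y, K.indicator (1 : Plane → ℝ) (y - w) = volume.real K := by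
    rw [integral_sub_right_eq_self (fun y => K.indicator (1 : Plane → ℝ) y) w, e1]
  have hpt : ∀ y, |K.indicator (1 : Plane → ℝ) (y - w) - K.indicator (1 : Plane → ℝ) y| ≤
      (K₂.indicator (1 : Plane → ℝ) y - K.indicator (1 : Plane → ℝ) (y - w)) +
      (K₂.indicator (1 : Plane → ℝ) y - K.indicator (1 : Plane → ℝ) y) := by
    intro y
    have m1 : y ∈ K → y ∈ K₂ := fun h => by
      have := subset_homothety hK hb hs (w := 0) (by rw [norm_zero]; exact mul_pos hs hr) h
      rwa [add_zero] at this
    have m2 : y - w ∈ K → y ∈ K₂ := fun h => by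
      have := subset_homothety hK hb hs hw h
      rwa [sub_add_cancel] at this
    by_cases h1 : y ∈ K <;> by_cases h2 : y - w ∈ K <;> by_cases h3 : y ∈ K₂ <;>
      simp_all
  calc _ ≤ ∫ y, ((K₂.indicator (1 : Plane → ℝ) y - K.indicator (1 : Plane → ℝ) (y - w)) +
      (K₂.indicator (1 : Plane → ℝ) y - K.indicator (1 : Plane → ℝ) y)) :=
        integral_mono (i3.sub i1).abs ((i2.sub i3).add (i2.sub i1)) hpt
    _ = _ := by
        have e4 := integral_add (i2.sub i3) (i2.sub i1)
        simp only [Pi.sub_apply] at e4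
        rw [e4, integral_sub i2 i3, integral_sub i2 i1, e1, e2, e3,
          hreal]
        ring

/-- Replaces the boundary integral of V by sup|V| times a perimeter bound. The difference quotient
is moved from V to the indicator of K, whose translates are close in L¹. -/
theorem abs_setIntegral_lineDeriv_le {K : Set Plane} (hK : Convex ℝ K) (hKo : IsOpen K)
    (hKb : Bornology.IsBounded K) {c : Plane} {r : ℝ} (hr : 0 < r) (hb : Metric.ball c r ⊆ K)
    {V : Plane → ℝ} {L : ℝ≥0} {S : ℝ} (hV : LipschitzWith L V) (hVS : ∀ x, |V x| ≤ S)
    {v : Plane} (hv : ‖v‖ = 1) :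
    |∫ x in K, lineDeriv ℝ V x v| ≤ 8 * S / r * volume.real K := by
  have hS : 0 ≤ S := (abs_nonneg _).trans (hVS 0)
  have hKfin : volume K ≠ ⊤ := hKb.measure_lt_top.ne
  set g : Plane → ℝ := K.indicator 1 with hg
  have i1 : Integrable g :=
    (integrable_indicator_iff hKo.measurableSet).2 (integrableOn_const (C := (1 : ℝ)) hKfin)
  have hlim := hV.integral_inv_smul_sub_mul_tendsto_integral_lineDeriv_mul i1 v
  have hint : ∫ x in K, lineDeriv ℝ V x v = ∫ x, lineDeriv ℝ V x v * g x := by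
    rw [← integral_indicator hKo.measurableSet]
    congr 1
    funext x
    by_cases hx : x ∈ K <;> simp [hg, hx]
  rw [hint]
  have hbound : Tendsto (fun t : ℝ => 8 * S / r * volume.real K +
      t * (8 * S / r ^ 2 * volume.real K)) (𝓝[>] 0)
      (𝓝 (8 * S / r * volume.real K)) := by
    have : Tendsto (fun t : ℝ => 8 * S / r * volume.real K +
      t * (8 * S / r ^ 2 * volume.real K)) (𝓝 0) (𝓝 (8 * S / r * volume.real K +
      0 * (8 * S / r ^ 2 * volume.real K))) := by
      apply Continuous.tendsto
      fun_prop
    rw [zero_mul, add_zero] at this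
    exact this.mono_left nhdsWithin_le_nhds
  refine le_of_tendsto_of_tendsto hlim.abs hbound ?_
  filter_upwards [self_mem_nhdsWithin] with t ht
  have ht : 0 < t := ht
  have hVg : ∀ h : Plane → ℝ, Integrable h → Integrable (fun x => V x * h x) := fun h hh =>
    hh.bdd_mul hV.continuous.aestronglyMeasurable (c := S)
      (Eventually.of_forall fun x => by rw [Real.norm_eq_abs]; exact hVS x)
  have i2 : Integrable (fun x => g (x - t • v)) := i1.comp_sub_right _
  have hshift : ∫ x, V (x + t • v) * g x = ∫ y, V y * g (y - t • v) := by
    rw [← integral_add_right_eq_self (fun y => V y * g (y - t • v)) (t • v)]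
    simp
  have i3 : Integrable (fun x => V (x + t • v) * g x) := by
    have := (hVg _ i2).comp_add_right (t • v)
    simpa using this
  have heq : ∫ x, t⁻¹ • (V (x + t • v) - V x) * g x =
      t⁻¹ * ∫ y, V y * (g (y - t • v) - g y) := by
    have e : ∀ x, t⁻¹ • (V (x + t • v) - V x) * g x =
        t⁻¹ * (V (x + t • v) * g x - V x * g x) := fun x => by rw [smul_eq_mul]; ring
    simp only [e, mul_sub (V _)]
    rw [integral_const_mul, integral_sub i3 (hVg _ i1), integral_sub (hVg _ i2) (hVg _ i1), hshift]
  -- The choice s = 2t/r makes the inequality strict; then (2/t)((1+s)² - 1) = 8/r + 8t/r², which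
  -- tends to 8/r.
  have hw : ‖t • v‖ < (2 * t / r) * r := by
    rw [norm_smul, hv, Real.norm_eq_abs, abs_of_pos ht]
    field_simp
    linarith
  have hmain := integral_abs_indicator_sub_le hK hKo hKb hr hb (s := 2 * t / r) (by positivity) hw
  rw [heq, abs_mul, abs_of_pos (inv_pos.2 ht)]
  calc t⁻¹ * |∫ y, V y * (g (y - t • v) - g y)|
      ≤ t⁻¹ * ∫ y, S * |g (y - t • v) - g y| := by
        gcongr
        rw [← Real.norm_eq_abs]
        refine norm_integral_le_of_norm_le ((i2.sub i1).abs.const_mul S)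
          (Eventually.of_forall fun y => ?_)
        rw [norm_mul, Real.norm_eq_abs, Real.norm_eq_abs]
        gcongr
        exact hVS y
    _ ≤ t⁻¹ * (S * (2 * ((1 + 2 * t / r) ^ 2 - 1) * volume.real K)) := by
        rw [integral_const_mul]
        gcongr
    _ = _ := by field_simp; ring

/-! ### Test functions -/

theorem IsTestFunction.partialDeriv {Ω : Set Plane} {φ : Plane → ℝ} (h : IsTestFunction Ω φ)
    (i : Fin 2) : IsTestFunction Ω (partialDeriv i φ) := by
  have hs : tsupport (PlateFEM.partialDeriv i φ) ⊆ tsupport φ := by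
    refine (closure_mono ?_).trans (tsupport_fderiv_subset ℝ (f := φ))
    intro x hx hx'
    apply hx
    simp [PlateFEM.partialDeriv, hx']
  exact ⟨(h.smooth.fderiv_right (m := ((⊤ : ℕ∞) : WithTop ℕ∞)) (by simp)).clm_apply contDiff_const,
    h.compact.of_isClosed_subset (isClosed_tsupport _) hs, hs.trans h.support⟩

theorem IsTestFunction.differentiable {Ω : Set Plane} {φ : Plane → ℝ} (h : IsTestFunction Ω φ) :
    Differentiable ℝ φ := h.smooth.differentiable (by simp)

theorem IsTestFunction.exists_lipschitzWith {Ω : Set Plane} {φ : Plane → ℝ}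
    (h : IsTestFunction Ω φ) : ∃ L, LipschitzWith L φ :=
  h.smooth.lipschitzWith_of_hasCompactSupport h.compact (by simp)

theorem IsTestFunction.eq_zero {Ω : Set Plane} {φ : Plane → ℝ} (h : IsTestFunction Ω φ) {x : Plane}
    (hx : x ∉ Ω) : φ x = 0 :=
  image_eq_zero_of_notMem_tsupport fun h' => hx (h.support h')

theorem partialDeriv_eq_lineDeriv {φ : Plane → ℝ} (h : Differentiable ℝ φ) (i : Fin 2) (x : Plane) :
    partialDeriv i φ x = lineDeriv ℝ φ x (EuclideanSpace.single i 1) :=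
  ((h x).lineDeriv_eq_fderiv).symm

/-- Integration by parts against a Lipschitz function. -/
theorem setIntegral_mul_partialDeriv {Ω : Set Plane} {F φ : Plane → ℝ} {L : ℝ≥0}
    (hF : LipschitzWith L F) (h : IsTestFunction Ω φ) (i : Fin 2) :
    ∫ x in Ω, F x * partialDeriv i φ x =
      -∫ x in Ω, lineDeriv ℝ F x (EuclideanSpace.single i 1) * φ x := by
  obtain ⟨D, hD⟩ := h.exists_lipschitzWith
  have hib := hF.integral_lineDeriv_mul_eq (μ := volume) hD h.compact (EuclideanSpace.single i 1)
  rw [setIntegral_eq_integral_of_forall_compl_eq_zero (fun x hx => by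
      rw [(h.partialDeriv i).eq_zero hx, mul_zero]),
    setIntegral_eq_integral_of_forall_compl_eq_zero (fun x hx => by
      rw [h.eq_zero hx, mul_zero]), hib, ← integral_neg]
  congr 1
  funext x
  rw [lineDeriv_neg, partialDeriv_eq_lineDeriv h.differentiable]
  ring

/-! ### Piecewise estimates -/

theorem isBounded_interior (t : Tri) : Bornology.IsBounded t.interior :=
  (isBounded_closedInterior t).subset t.interior_subset_closedInterior

/-- On a triangle, the pairing of a partial derivative with a derivative of a test function is bounded by
the second derivatives and the boundary values. -/
theorem abs_setIntegral_mul_partialDeriv_le {t : Tri} {ctr : Plane} {r c : ℝ} (hr : 0 < r)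
    (hb : Metric.ball ctr r ⊆ t.interior) {f : Plane → ℝ} (hc : 0 ≤ c)
    (hf : C2Bound t.closedInterior (2 / r) c f) {Ω : Set Plane} {φ : Plane → ℝ}
    (hφ : IsTestFunction Ω φ) (hφ1 : ∀ x ∈ t.interior, |φ x| ≤ 1) (i j : Fin 2) :
    |∫ x in t.interior, lineDeriv ℝ f x (EuclideanSpace.single i 1) * partialDeriv j φ x| ≤
      5 * (c * (2 / r) ^ 2) * volume.real t.interior := by
  obtain ⟨f₁, f₂, hf⟩ := hf
  set ei : Plane := EuclideanSpace.single i 1 with hei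
  set ej : Plane := EuclideanSpace.single j 1 with hej
  have nei : ‖ei‖ = 1 := by simp [hei]
  have nej : ‖ej‖ = 1 := by simp [hej]
  have ho := isOpen_interior t
  have hsub := t.interior_subset_closedInterior
  have hnhds : ∀ x ∈ t.interior, t.closedInterior ∈ 𝓝 x := fun x hx =>
    mem_of_superset (ho.mem_nhds hx) hsub
  have hfin : volume t.interior < ⊤ := (isBounded_interior t).measure_lt_top
  have hd1 : ∀ x ∈ t.interior, HasFDerivAt f (f₁ x) x := fun x hx =>
    (hf x (hsub hx)).1.hasFDerivAt (hnhds x hx)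
  have hd2 : ∀ x ∈ t.interior, HasFDerivAt f₁ (f₂ x) x := fun x hx =>
    (hf x (hsub hx)).2.1.hasFDerivAt (hnhds x hx)
  have hw : ∀ x ∈ t.interior, HasFDerivAt (fun y => f₁ y ei) ((f₂ x).flip ei) x := by
    intro x hx
    refine ((hd2 x hx).clm_apply (hasFDerivAt_const ei x)).congr_fderiv ?_
    ext v
    simp
  have hwb : ∀ x ∈ t.closedInterior, |f₁ x ei| ≤ c * (2 / r) := by
    intro x hx
    have h := (f₁ x).le_opNorm ei
    rw [nei, mul_one, Real.norm_eq_abs] at h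
    exact h.trans (hf x hx).2.2.2.1
  have hw2 : ∀ x ∈ t.interior, ∀ v, |f₂ x v ei| ≤ c * (2 / r) ^ 2 * ‖v‖ := by
    intro x hx v
    have h := (f₂ x v).le_opNorm ei
    rw [nei, mul_one, Real.norm_eq_abs] at h
    refine h.trans (((f₂ x).le_opNorm v).trans ?_)
    exact mul_le_mul_of_nonneg_right (hf x (hsub hx)).2.2.2.2 (norm_nonneg v)
  obtain ⟨D, hD⟩ := hφ.exists_lipschitzWith
  have hφd := hφ.differentiable
  have hV : ∀ x ∈ t.interior, HasFDerivAt (fun y => f₁ y ei * φ y)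
      (f₁ x ei • fderiv ℝ φ x + φ x • (f₂ x).flip ei) x := fun x hx =>
    (hw x hx).mul (hφd x).hasFDerivAt
  have hVL : LipschitzOnWith (Real.toNNReal (c * (2 / r) * D + c * (2 / r) ^ 2))
      (fun y => f₁ y ei * φ y) t.interior := by
    refine (convex_interior t).lipschitzOnWith_of_nnnorm_hasFDerivWithin_le
      (fun x hx => (hV x hx).hasFDerivWithinAt) fun x hx => ?_
    rw [← NNReal.coe_le_coe, coe_nnnorm, Real.coe_toNNReal _ (by positivity)]
    refine (ContinuousLinearMap.opNorm_add_le _ _).trans (add_le_add ?_ ?_)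
    · rw [opNorm_smul_eq]
      exact mul_le_mul (hwb x (hsub hx)) (norm_fderiv_le_of_lipschitz ℝ hD) (norm_nonneg _)
        (by positivity)
    · refine ContinuousLinearMap.opNorm_le_bound _ (by positivity) fun v => ?_
      rw [smul_apply, ContinuousLinearMap.flip_apply, smul_eq_mul, norm_mul, Real.norm_eq_abs,
        Real.norm_eq_abs]
      calc |φ x| * |f₂ x v ei| ≤ 1 * (c * (2 / r) ^ 2 * ‖v‖) := by
            gcongr
            · exact hφ1 x hx
            · exact hw2 x hx v
        _ = _ := one_mul _
  have hVS : ∀ x ∈ t.interior, |f₁ x ei * φ x| ≤ c * (2 / r) := by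
    intro x hx
    rw [abs_mul]
    calc |f₁ x ei| * |φ x| ≤ c * (2 / r) * 1 := by
          gcongr
          · exact hwb x (hsub hx)
          · exact hφ1 x hx
      _ = _ := mul_one _
  -- The divergence estimate asks for a bounded Lipschitz function on the whole plane; only its
  -- values on the open triangle matter.
  obtain ⟨W, hW, hWS, hVW⟩ := exists_bounded_extension (by positivity) hVL hVS
  have hdiv := abs_setIntegral_lineDeriv_le (convex_interior t) ho (isBounded_interior t) hr hb hW
    hWS nej
  have hWd : ∀ x ∈ t.interior, lineDeriv ℝ W x ej =
      f₁ x ei * partialDeriv j φ x + φ x * f₂ x ej ei := by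
    intro x hx
    have : HasFDerivAt W (f₁ x ei • fderiv ℝ φ x + φ x • (f₂ x).flip ei) x :=
      (hV x hx).congr_of_eventuallyEq (by
        filter_upwards [ho.mem_nhds hx] with y hy using (hVW hy).symm)
    rw [(this.hasLineDerivAt ej).lineDeriv]
    simp [partialDeriv, hej]
  have hint1 : IntegrableOn (fun x => lineDeriv ℝ W x ej) t.interior := by
    refine Measure.integrableOn_of_bounded hfin.ne
      (measurable_lineDeriv hW.continuous).aestronglyMeasurable
      (M := (Real.toNNReal (c * (2 / r) * D + c * (2 / r) ^ 2) : ℝ) * ‖ej‖)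
      (Eventually.of_forall fun x => norm_lineDeriv_le_of_lipschitz ℝ hW)
  have hwcont : ContinuousOn (fun y => f₁ y ei) t.interior := fun x hx =>
    (hw x hx).continuousAt.continuousWithinAt
  have hint2 : IntegrableOn (fun x => f₁ x ei * partialDeriv j φ x) t.interior := by
    have : Fact (volume t.interior < ⊤) := ⟨hfin⟩
    refine Integrable.of_bound
      ((hwcont.mul (hφ.partialDeriv j).smooth.continuous.continuousOn).aestronglyMeasurable
        ho.measurableSet) (c * (2 / r) * D) ?_
    refine (ae_restrict_iff' ho.measurableSet).2 (Eventually.of_forall fun x hx => ?_)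
    rw [norm_mul]
    refine mul_le_mul (hwb x (hsub hx)) ?_ (norm_nonneg _) (by positivity)
    have h := (fderiv ℝ φ x).le_opNorm ej
    rw [nej, mul_one] at h
    exact h.trans (norm_fderiv_le_of_lipschitz ℝ hD)
  have hrest : |∫ x in t.interior, (lineDeriv ℝ W x ej - f₁ x ei * partialDeriv j φ x)| ≤
      c * (2 / r) ^ 2 * volume.real t.interior := by
    rw [← Real.norm_eq_abs]
    refine norm_setIntegral_le_of_norm_le_const hfin fun x hx => ?_
    rw [hWd x hx, add_sub_cancel_left, norm_mul, Real.norm_eq_abs, Real.norm_eq_abs]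
    have h2 := hw2 x hx ej
    rw [nej, mul_one] at h2
    calc |φ x| * |f₂ x ej ei| ≤ 1 * (c * (2 / r) ^ 2) := by
          gcongr
          exact hφ1 x hx
      _ = _ := one_mul _
  have hfeq : ∫ x in t.interior, lineDeriv ℝ f x ei * partialDeriv j φ x =
      ∫ x in t.interior, f₁ x ei * partialDeriv j φ x :=
    setIntegral_congr_fun ho.measurableSet fun x hx => by
      simp only [((hd1 x hx).hasLineDerivAt ei).lineDeriv]
  rw [integral_sub hint1 hint2] at hrest
  rw [hfeq]
  -- With S = c(2/r) the boundary term contributes 4 and the term φ ∂ⱼ∂ᵢf contributes 1, in total 5.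
  have h8 : 8 * (c * (2 / r)) / r = 4 * (c * (2 / r) ^ 2) := by field_simp; ring
  rw [h8] at hdiv
  rw [abs_le] at hdiv hrest ⊢
  constructor <;> linarith [hdiv.1, hdiv.2, hrest.1, hrest.2]

theorem IsConvexPolygonalDomain.interior_closure {Ω : Set Plane} (h : IsConvexPolygonalDomain Ω) :
    interior (closure Ω) = Ω := by
  rw [h.convex.interior_closure_eq_interior_of_nonempty_interior
    (by rw [h.isOpen.interior_eq]; exact h.nonempty), h.isOpen.interior_eq]

theorem IsConvexPolygonalDomain.isBounded_closure {Ω : Set Plane}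
    (h : IsConvexPolygonalDomain Ω) : Bornology.IsBounded (closure Ω) := by
  obtain ⟨V, hV⟩ := h.polygonal
  rw [hV]
  exact isBounded_convexHull.2 V.finite_toSet.isBounded

theorem IsConvexPolygonalDomain.volume_lt_top {Ω : Set Plane}
    (h : IsConvexPolygonalDomain Ω) : volume Ω < ⊤ :=
  (h.isBounded_closure.subset subset_closure).measure_lt_top

theorem interior_subset {Ω : Set Plane} (hΩ : IsConvexPolygonalDomain Ω) {𝒯 : Finset Tri}
    (h : IsTriangulation Ω 𝒯) {t : Tri} (ht : t ∈ 𝒯) : t.interior ⊆ Ω := by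
  rw [← interior_closedInterior, ← hΩ.interior_closure]
  exact interior_mono (closedInterior_subset_closure h ht)

/-- The missing points lie on frontiers of convex sets, which are null. -/
theorem iUnion_interior_ae_eq {Ω : Set Plane} (hΩ : IsConvexPolygonalDomain Ω) {𝒯 : Finset Tri}
    (h : IsTriangulation Ω 𝒯) : (⋃ t ∈ 𝒯, t.interior : Set Plane) =ᵐ[volume] Ω := by
  refine ae_eq_set.2 ⟨?_, ?_⟩
  · have : (⋃ t ∈ 𝒯, t.interior : Set Plane) ⊆ Ω :=
      Set.iUnion₂_subset fun t ht => interior_subset hΩ h ht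
    rw [Set.sdiff_eq_empty.2 this, measure_empty]
  · refine measure_mono_null (t := ⋃ t ∈ 𝒯, frontier t.closedInterior) ?_ ?_
    · rintro x ⟨hx, hx'⟩
      have := subset_closure hx
      rw [← h.cover] at this
      simp only [Set.mem_iUnion] at this hx' ⊢
      obtain ⟨t, ht, hxt⟩ := this
      refine ⟨t, ht, ?_⟩
      rw [frontier, (isClosed_closedInterior t).closure_eq, interior_closedInterior]
      exact ⟨hxt, fun h => hx' ⟨t, ht, h⟩⟩
    · refine (measure_biUnion_null_iff 𝒯.countable_toSet).2 ?_
      exact fun t _ => (convex_closedInterior t).addHaar_frontier volume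

/-- Local bounds for a function on the triangles of a triangulation. -/
def PiecewiseBound (𝒯 : Finset Tri) (f : Plane → ℝ) (A B D : ℝ) : Prop :=
  ∀ t ∈ 𝒯, ∃ (ctr : Plane) (r c : ℝ), 0 < r ∧ 0 ≤ c ∧ Metric.ball ctr r ⊆ t.interior ∧
    C2Bound t.closedInterior (2 / r) c f ∧ c ≤ A ∧ c * (2 / r) ≤ B ∧ c * (2 / r) ^ 2 ≤ D

/-- Continuity across edges is implicit: one function f satisfies the bounds on every closed
triangle. -/
theorem PiecewiseBound.lipschitzOnWith {Ω : Set Plane} (hΩ : IsConvexPolygonalDomain Ω)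
    {𝒯 : Finset Tri} (h : IsTriangulation Ω 𝒯) {f : Plane → ℝ} {A B D : ℝ}
    (hf : PiecewiseBound 𝒯 f A B D) : LipschitzOnWith (Real.toNNReal B) f (closure Ω) := by
  have hc := hΩ.convex.closure
  rw [← h.cover] at hc ⊢
  refine lipschitzOnWith_biUnion (fun t _ => isClosed_closedInterior t) hc fun t ht => ?_
  obtain ⟨ctr, r, c, hr, hc0, hb, hf, hA, hB, hD⟩ := hf t ht
  exact (hf.lipschitzOnWith (convex_closedInterior t)).weaken (Real.toNNReal_le_toNNReal hB)

/-- The line derivatives of a Lipschitz extension form a weak gradient; two components of size at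
most B give 2 * B. -/
theorem normW11_le {Ω : Set Plane} (hΩ : IsConvexPolygonalDomain Ω)
    {𝒯 : Finset Tri} (h : IsTriangulation Ω 𝒯) {f : Plane → ℝ} {A B D : ℝ}
    (hB0 : 0 ≤ B) (hf : PiecewiseBound 𝒯 f A B D) :
    normW11 Ω f ≤ volume Ω * ENNReal.ofReal A + volume Ω * ENNReal.ofReal (2 * B) := by
  have hL := hf.lipschitzOnWith hΩ h
  obtain ⟨F, hF, hfF⟩ := hL.extend_real
  have hΩm := hΩ.isOpen.measurableSet
  set g : Plane → Plane := fun x => WithLp.toLp 2 fun i =>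
    lineDeriv ℝ F x (EuclideanSpace.single i 1)
  have hgm : Measurable g := (WithLp.measurable_toLp 2 (Fin 2 → ℝ)).comp
    (measurable_pi_lambda _ fun i => measurable_lineDeriv hF.continuous)
  have hgi : ∀ x i, |g x i| ≤ B := by
    intro x i
    have := norm_lineDeriv_le_of_lipschitz ℝ (x₀ := x) (v := EuclideanSpace.single i 1) hF
    rw [Real.coe_toNNReal _ hB0] at this
    simpa using this
  have hgn : ∀ x, ‖g x‖ ≤ 2 * B := by
    intro x
    conv_lhs => rw [plane_eq_sum (g x)]
    refine (norm_add_le _ _).trans ?_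
    rw [norm_smul, norm_smul]
    have h0 := hgi x 0
    have h1 := hgi x 1
    simp
    linarith
  have hweak : IsWeakGradient Ω f g := by
    refine ⟨?_, ?_, ?_⟩
    · exact (hL.continuousOn.mono subset_closure).locallyIntegrableOn hΩm
    · refine (Measure.integrableOn_of_bounded (M := 2 * B) hΩ.volume_lt_top.ne
        hgm.aestronglyMeasurable ?_).locallyIntegrableOn
      exact Eventually.of_forall hgn
    · intro φ hφ i
      rw [setIntegral_congr_fun hΩm (g := fun x => F x * partialDeriv i φ x)
        (fun x hx => by simp only [hfF (subset_closure hx)]), setIntegral_mul_partialDeriv hF hφ i]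
  refine (iInf₂_le g hweak).trans (add_le_add ?_ ?_)
  · refine (eLpNorm_le_of_ae_bound (C := A) ?_).trans (by simp)
    refine (ae_restrict_iff' hΩm).2 (Eventually.of_forall fun x hx => ?_)
    have hx' := subset_closure hx
    rw [← h.cover] at hx'
    simp only [Set.mem_iUnion] at hx'
    obtain ⟨t, ht, hxt⟩ := hx'
    obtain ⟨ctr, r, c, hr, hc0, hb, ⟨f₁, f₂, hf⟩, hA, hB, hD⟩ := hf t ht
    exact (hf x hxt).2.2.1.trans hA
  · exact (eLpNorm_le_of_ae_bound (Eventually.of_forall hgn)).trans (by simp)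

/-- Only one derivative is moved onto f over all of Ω, since ∇f may jump across edges; the other is
treated on each triangle, where the jumps are absorbed in the boundary terms. The 20 is 5 for each
of four index pairs. -/
theorem hessianVariation_le {Ω : Set Plane} (hΩ : IsConvexPolygonalDomain Ω)
    {𝒯 : Finset Tri} (h : IsTriangulation Ω 𝒯) {f : Plane → ℝ} {A B D : ℝ}
    (hf : PiecewiseBound 𝒯 f A B D) :
    hessianVariation Ω f ≤ volume Ω * ENNReal.ofReal (20 * D) := by
  have hL := hf.lipschitzOnWith hΩ h
  obtain ⟨F, hF, hfF⟩ := hL.extend_real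
  have hΩm := hΩ.isOpen.measurableSet
  have hΩfin := hΩ.volume_lt_top
  have hvol : ∑ t ∈ 𝒯, volume.real (t.interior : Set Plane) = volume.real Ω := by
    rw [← measureReal_congr (iUnion_interior_ae_eq hΩ h)]
    refine (measureReal_biUnion_finset (fun s hs t ht hst => h.disjoint s hs t ht hst)
      (fun t _ => (isOpen_interior t).measurableSet)
      (fun t _ => (isBounded_interior t).measure_lt_top.ne)).symm
  refine iSup₂_le fun φ hφ => ?_
  have hφ1 : ∀ i j, ∀ x ∈ Ω, |φ i j x| ≤ 1 := by
    intro i j x hx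
    refine le_trans ?_ (hφ.frobenius x hx)
    refine Real.abs_le_sqrt ?_
    calc φ i j x ^ 2 ≤ ∑ j, φ i j x ^ 2 :=
          Finset.single_le_sum (f := fun j => φ i j x ^ 2) (fun _ _ => sq_nonneg _)
            (Finset.mem_univ j)
      _ ≤ ∑ i, ∑ j, φ i j x ^ 2 :=
          Finset.single_le_sum (f := fun i => ∑ j, φ i j x ^ 2)
            (fun _ _ => Finset.sum_nonneg fun _ _ => sq_nonneg _) (Finset.mem_univ i)
  have hint0 : ∀ {w : Plane → ℝ}, Continuous w → HasCompactSupport w →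
      IntegrableOn (fun x => F x * w x) Ω := fun hw hc =>
    ((hF.continuous.mul hw).integrable_of_hasCompactSupport hc.mul_left).integrableOn
  have hpair : ∀ i j, |∫ x in Ω, F x * partialDeriv i (partialDeriv j (φ i j)) x| ≤
      5 * D * volume.real Ω := by
    intro i j
    have hψ := (hφ.test i j).partialDeriv j
    rw [setIntegral_mul_partialDeriv hF hψ i, abs_neg,
      ← setIntegral_congr_set (iUnion_interior_ae_eq hΩ h)]
    have hbd : Integrable (fun x => lineDeriv ℝ F x (EuclideanSpace.single i 1) *
        partialDeriv j (φ i j) x) :=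
      (hψ.smooth.continuous.integrable_of_hasCompactSupport hψ.compact).bdd_mul
        (measurable_lineDeriv hF.continuous).aestronglyMeasurable
        (Eventually.of_forall fun x => norm_lineDeriv_le_of_lipschitz ℝ hF)
    rw [integral_biUnion_finset 𝒯 (fun t _ => (isOpen_interior t).measurableSet)
      (fun s hs t ht hst => h.disjoint s hs t ht hst) (fun t _ => hbd.integrableOn), ← hvol,
      Finset.mul_sum]
    refine (Finset.abs_sum_le_sum_abs _ _).trans (Finset.sum_le_sum fun t ht => ?_)
    obtain ⟨ctr, r, c, hr, hc0, hb, hf, hA, hB, hD⟩ := hf t ht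
    have hcl := closedInterior_subset_closure h ht
    have := abs_setIntegral_mul_partialDeriv_le hr hb hc0
      (hf.congr fun x hx => (hfF (hcl hx)).symm) (hφ.test i j)
      (fun x hx => hφ1 i j x (interior_subset hΩ h ht hx)) i j
    refine this.trans ?_
    gcongr
  have hsum : ∫ x in Ω, f x * divDiv φ x =
      ∑ i, ∑ j, ∫ x in Ω, F x * partialDeriv i (partialDeriv j (φ i j)) x := by
    have hI : ∀ i j, IntegrableOn (fun x => F x * partialDeriv i (partialDeriv j (φ i j)) x) Ω := by
      intro i j
      have hψ := ((hφ.test i j).partialDeriv j).partialDeriv i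
      exact hint0 hψ.smooth.continuous hψ.compact
    rw [setIntegral_congr_fun hΩm (g := fun x => ∑ i, ∑ j,
      F x * partialDeriv i (partialDeriv j (φ i j)) x) (fun x hx => by
        simp only [hfF (subset_closure hx), divDiv, Finset.mul_sum])]
    rw [integral_finsetSum _ fun i _ => integrable_finsetSum _ fun j _ => hI i j]
    exact Finset.sum_congr rfl fun i _ => integral_finsetSum _ fun j _ => hI i j
  have hle : ∫ x in Ω, f x * divDiv φ x ≤ volume.real Ω * (20 * D) := by
    rw [hsum]
    simp only [Fin.sum_univ_two]
    have h00 := (le_abs_self _).trans (hpair 0 0)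
    have h01 := (le_abs_self _).trans (hpair 0 1)
    have h10 := (le_abs_self _).trans (hpair 1 0)
    have h11 := (le_abs_self _).trans (hpair 1 1)
    linarith
  refine (ENNReal.ofReal_le_ofReal hle).trans_eq ?_
  rw [ENNReal.ofReal_mul measureReal_nonneg, ofReal_measureReal hΩfin.ne]

/-! ### Regularity of `u` on the closed domain -/

/-- The bound holds almost everywhere, and by continuity of the third derivative it fails on an open
set, which is null and hence empty. -/
theorem norm_iteratedFDeriv_le {Ω : Set Plane} (hΩ : IsConvexPolygonalDomain Ω) {u : Plane → ℝ}
    (hu : ContDiffOn ℝ 3 u (closure Ω)) (hM : thirdDerivNorm Ω u ≠ ⊤) :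
    ∀ x ∈ Ω, ‖iteratedFDeriv ℝ 3 u x‖ ≤ (thirdDerivNorm Ω u).toReal := by
  have hΩo := hΩ.isOpen
  have hae : ∀ᵐ x ∂(volume.restrict Ω), ‖iteratedFDeriv ℝ 3 u x‖ ≤ (thirdDerivNorm Ω u).toReal := by
    have h := ae_le_eLpNormEssSup (f := iteratedFDeriv ℝ 3 u) (μ := volume.restrict Ω)
    filter_upwards [h] with x hx
    rw [← eLpNorm_exponent_top] at hx
    rw [← toReal_enorm]
    exact ENNReal.toReal_mono hM hx
  have hcont : ContinuousOn (fun x => ‖iteratedFDeriv ℝ 3 u x‖) Ω := by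
    have h := (hu.mono subset_closure).continuousOn_iteratedFDerivWithin le_rfl hΩo.uniqueDiffOn
    exact (h.congr fun x hx => (iteratedFDerivWithin_of_isOpen 3 hΩo hx).symm).norm
  have hopen : IsOpen (Ω ∩ (fun x => ‖iteratedFDeriv ℝ 3 u x‖) ⁻¹'
      Set.Ioi (thirdDerivNorm Ω u).toReal) := hcont.isOpen_inter_preimage hΩo isOpen_Ioi
  rw [ae_restrict_iff' hΩo.measurableSet, ae_iff] at hae
  have hnull := (hopen.measure_eq_zero_iff volume).1 (measure_mono_null (fun x hx => by
    simpa using hx) hae)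
  intro x hx
  by_contra hlt
  exact (Set.eq_empty_iff_forall_notMem.1 hnull x) ⟨hx, not_le.1 hlt⟩

theorem IsConvexPolygonalDomain.uniqueDiffOn_closure {Ω : Set Plane}
    (hΩ : IsConvexPolygonalDomain Ω) : UniqueDiffOn ℝ (closure Ω) :=
  uniqueDiffOn_convex hΩ.convex.closure (by rw [hΩ.interior_closure]; exact hΩ.nonempty)

/-- On the open convex set Ω the mean value inequality gives the Lipschitz bound, which passes to
the closure by continuity. -/
theorem c21Bound_of_contDiffOn {Ω : Set Plane} (hΩ : IsConvexPolygonalDomain Ω) {u : Plane → ℝ}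
    (hu : ContDiffOn ℝ 3 u (closure Ω)) (hM : thirdDerivNorm Ω u ≠ ⊤) :
    C21Bound (closure Ω) (thirdDerivNorm Ω u).toReal u (fderivWithin ℝ u (closure Ω))
      (fderivWithin ℝ (fderivWithin ℝ u (closure Ω)) (closure Ω)) := by
  set K := closure Ω with hK
  set M := (thirdDerivNorm Ω u).toReal
  have hM0 : 0 ≤ M := ENNReal.toReal_nonneg
  have hΩo := hΩ.isOpen
  have hU : UniqueDiffOn ℝ K := hΩ.uniqueDiffOn_closure
  have h1 : ContDiffOn ℝ 2 (fderivWithin ℝ u K) K := hu.fderivWithin hU (by norm_num)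
  have hlipΩ : LipschitzOnWith (Real.toNNReal M) (iteratedFDerivWithin ℝ 2 u K) Ω := by
    have hat : ∀ x ∈ Ω, ContDiffAt ℝ 3 u x := fun x hx =>
      hu.contDiffAt (mem_of_superset (hΩo.mem_nhds hx) subset_closure)
    have h : LipschitzOnWith (Real.toNNReal M) (iteratedFDeriv ℝ 2 u) Ω := by
      refine hΩ.convex.lipschitzOnWith_of_nnnorm_fderiv_le (𝕜 := ℝ)
        (fun x hx => (hat x hx).differentiableAt_iteratedFDeriv (by norm_num)) fun x hx => ?_
      rw [← NNReal.coe_le_coe, coe_nnnorm, norm_fderiv_iteratedFDeriv, Real.coe_toNNReal _ hM0]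
      exact norm_iteratedFDeriv_le hΩ hu hM x hx
    intro x hx y hy
    rw [iteratedFDerivWithin_eq_iteratedFDeriv hU ((hat x hx).of_le (by norm_num))
      (subset_closure hx), iteratedFDerivWithin_eq_iteratedFDeriv hU ((hat y hy).of_le (by norm_num))
      (subset_closure hy)]
    exact h hx hy
  have hlip : LipschitzOnWith (Real.toNNReal M) (iteratedFDerivWithin ℝ 2 u K) K :=
    hlipΩ.closure (hu.continuousOn_iteratedFDerivWithin (by norm_num) hU)
  refine ⟨hM0, fun x hx => ?_, fun x hx => ?_, fun x hx y hy => ?_, fun x hx v w => ?_⟩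
  · exact (hu.differentiableOn (by norm_num) x hx).hasFDerivWithinAt
  · exact (h1.differentiableOn (by norm_num) x hx).hasFDerivWithinAt
  · have hd := hlip.dist_le_mul x hx y hy
    rw [dist_eq_norm, dist_eq_norm, Real.coe_toNNReal _ hM0] at hd
    refine ContinuousLinearMap.opNorm_le_bound₂ _ (by positivity) fun v w => ?_
    have e : (fderivWithin ℝ (fderivWithin ℝ u K) K x - fderivWithin ℝ (fderivWithin ℝ u K) K y) v w
        = (iteratedFDerivWithin ℝ 2 u K x - iteratedFDerivWithin ℝ 2 u K y) ![v, w] := by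
      rw [sub_apply, sub_apply, sub_apply, iteratedFDerivWithin_two_apply _ hU hx,
        iteratedFDerivWithin_two_apply _ hU hy]
      rfl
    rw [e]
    have hm := (iteratedFDerivWithin ℝ 2 u K x - iteratedFDerivWithin ℝ 2 u K y).le_opNorm ![v, w]
    rw [Fin.prod_univ_two] at hm
    refine hm.trans ?_
    simp only [Matrix.cons_val_zero, Matrix.cons_val_one]
    rw [mul_assoc _ ‖v‖ ‖w‖]
    gcongr
  -- Symmetry extends to boundary points because they are limits of interior points.
  · refine ((hu x hx).isSymmSndFDerivWithinAt (by simp; norm_num) hU ?_ hx) v w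
    rw [hK, hΩ.interior_closure]
    exact hx

/-! ### Global estimates -/

/-- The supremum is not shown to be attained, so half of a is given up; the diameter is at most 2r,
which gives a/4. -/
theorem exists_ball_of_le_inscribedDiam {T : Set Plane} {a : ℝ} (ha : 0 < a)
    (h : a ≤ inscribedDiam T) : ∃ (x : Plane) (r : ℝ), a / 4 ≤ r ∧ Metric.ball x r ⊆ T := by
  have hne : {d : ℝ | ∃ (x : Plane) (r : ℝ), Metric.ball x r ⊆ T ∧
      d = Metric.diam (Metric.ball x r)}.Nonempty := ⟨_, 0, 0, by simp, rfl⟩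
  have hlt : a / 2 < inscribedDiam T := by linarith
  obtain ⟨d, ⟨x, r, hb, rfl⟩, hd⟩ := exists_lt_of_lt_csSup hne hlt
  refine ⟨x, r, ?_, hb⟩
  rcases le_or_gt r 0 with hr | hr
  · rw [Metric.ball_eq_empty.2 hr, Metric.diam_empty] at hd
    linarith
  · have := Metric.diam_ball (x := x) hr.le
    linarith

/-- r ≥ ρd/4 gives 2/r ≤ 8/(ρd), whence 40000 = 5000 · 8 and 320000 = 5000 · 8². In the bound on
values, h² suffices, so one factor d is bounded by diam Ω only. -/
theorem piecewiseBound_interp {Ω : Set Plane} (hΩ : IsConvexPolygonalDomain Ω) {ρ : ℝ} (hρ : 0 < ρ)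
    {𝒯 : Finset Tri} (h𝒯 : IsTriangulation Ω 𝒯) {h : ℝ}
    (hdiam : ∀ t ∈ 𝒯, Metric.diam t.interior ≤ h * Metric.diam Ω)
    (hnd : ∀ t ∈ 𝒯, ρ * Metric.diam t.interior ≤ inscribedDiam t.interior)
    {loc : Tri → (Plane → ℝ) → Plane → ℝ} (hloc : LocalErrorBound loc) {u : Plane → ℝ}
    (hcomp : Compatible loc 𝒯 u) {M : ℝ} {u₁ : Plane → Plane →L[ℝ] ℝ}
    {u₂ : Plane → Plane →L[ℝ] Plane →L[ℝ] ℝ} (hu : C21Bound (closure Ω) M u u₁ u₂) :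
    PiecewiseBound 𝒯 (fun x => u x - globalInterp loc 𝒯 u x)
      (5000 * Metric.diam Ω ^ 3 * h ^ 2 * M) (40000 * Metric.diam Ω ^ 2 / ρ * h ^ 2 * M)
      (320000 * Metric.diam Ω / ρ ^ 2 * h * M) := by
  intro t ht
  have hM := hu.nonneg
  have hd : 0 < Metric.diam t.interior := by
    obtain ⟨x, hx⟩ := nonempty_interior t
    obtain ⟨ε, hε, hb⟩ := Metric.isOpen_iff.1 (isOpen_interior t) x hx
    have := half_radius_le_diam hε hb
    linarith
  have hdh := hdiam t ht
  have hdD : Metric.diam t.interior ≤ Metric.diam Ω :=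
    Metric.diam_mono (interior_subset hΩ h𝒯 ht) (hΩ.isBounded_closure.subset subset_closure)
  obtain ⟨ctr, r, hr, hb⟩ := exists_ball_of_le_inscribedDiam (mul_pos hρ hd) (hnd t ht)
  set d := Metric.diam t.interior
  set D := Metric.diam Ω
  have hr0 : 0 < r := lt_of_lt_of_le (by positivity) hr
  have hG : 2 / r ≤ 8 / (ρ * d) := by
    rw [div_le_div_iff₀ hr0 (by positivity)]
    linarith
  have hD0 : 0 < D := hd.trans_le hdD
  have hd2 : d ^ 2 ≤ (h * D) ^ 2 := by gcongr
  refine ⟨ctr, r, 5000 * (M * d ^ 3), hr0, by positivity, hb, ?_, ?_, ?_, ?_⟩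
  · exact (hloc t (closure Ω) M r ctr u u₁ u₂ hu (closedInterior_subset_closure h𝒯 ht) hr0
      hb).congr fun x hx => by rw [globalInterp_eq hcomp ht hx]
  · calc 5000 * (M * d ^ 3) = 5000 * M * (d ^ 2 * d) := by ring
      _ ≤ 5000 * M * ((h * D) ^ 2 * D) := by gcongr
      _ = _ := by ring
  · calc 5000 * (M * d ^ 3) * (2 / r) ≤ 5000 * (M * d ^ 3) * (8 / (ρ * d)) := by gcongr
      _ = 40000 * M / ρ * d ^ 2 := by field_simp; ring
      _ ≤ 40000 * M / ρ * (h * D) ^ 2 := by gcongr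
      _ = _ := by ring
  · calc 5000 * (M * d ^ 3) * (2 / r) ^ 2 ≤ 5000 * (M * d ^ 3) * (8 / (ρ * d)) ^ 2 := by gcongr
      _ = 320000 * M / ρ ^ 2 * d := by field_simp; ring
      _ ≤ 320000 * M / ρ ^ 2 * (h * D) := by gcongr
      _ = _ := by ring

/-- The constant in the interpolation estimates. -/
def interpConst (Ω : Set Plane) (ρ : ℝ) : ℝ :=
  1 + 5000 * Metric.diam Ω ^ 3 + 80000 * Metric.diam Ω ^ 2 / ρ +
    6400000 * Metric.diam Ω / ρ ^ 2

theorem interpConst_pos (Ω : Set Plane) {ρ : ℝ} (hρ : 0 < ρ) : 0 < interpConst Ω ρ := by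
  have := Metric.diam_nonneg (s := Ω)
  unfold interpConst
  positivity

/-- `interpConst` collects 5000, then 80000 = 2 · 40000 from the gradient and 6400000 = 20 · 320000
from the Hessian; its summand 1 makes it positive at once. -/
theorem interp_estimate {Ω : Set Plane} (hΩ : IsConvexPolygonalDomain Ω) {ρ : ℝ} (hρ : 0 < ρ)
    {𝒯 : Finset Tri} (h𝒯 : IsTriangulation Ω 𝒯) {h : ℝ}
    (hdiam : ∀ t ∈ 𝒯, Metric.diam t.interior ≤ h * Metric.diam Ω)
    (hnd : ∀ t ∈ 𝒯, ρ * Metric.diam t.interior ≤ inscribedDiam t.interior)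
    {loc : Tri → (Plane → ℝ) → Plane → ℝ} (hloc : LocalErrorBound loc) {u : Plane → ℝ}
    (hu : ContDiffOn ℝ 3 u (closure Ω)) (hcomp : Compatible loc 𝒯 u) :
    normW11 Ω (fun x => u x - globalInterp loc 𝒯 u x) ≤
        (interpConst Ω ρ).toNNReal * volume Ω * ENNReal.ofReal (h ^ 2) * thirdDerivNorm Ω u ∧
      hessianVariation Ω (fun x => u x - globalInterp loc 𝒯 u x) ≤
        (interpConst Ω ρ).toNNReal * volume Ω * ENNReal.ofReal h * thirdDerivNorm Ω u := by
  have hC := interpConst_pos Ω hρ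
  have hD := Metric.diam_nonneg (s := Ω)
  have hh : 0 < h := by
    obtain ⟨x, hx⟩ := hΩ.nonempty
    have hx' := subset_closure hx
    rw [← h𝒯.cover] at hx'
    simp only [Set.mem_iUnion] at hx'
    obtain ⟨t, ht, -⟩ := hx'
    obtain ⟨y, hy⟩ := nonempty_interior t
    obtain ⟨ε, hε, hb⟩ := Metric.isOpen_iff.1 (isOpen_interior t) y hy
    have h1 := half_radius_le_diam hε hb
    have h2 := hdiam t ht
    exact pos_of_mul_pos_left (by linarith : 0 < h * Metric.diam Ω) hD
  -- For an infinite norm both right-hand sides are ⊤, as the other factors are nonzero.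
  rcases eq_or_ne (thirdDerivNorm Ω u) ⊤ with hM | hM
  · have hvol : volume Ω ≠ 0 := (hΩ.isOpen.measure_pos volume hΩ.nonempty).ne'
    have hC' : ((interpConst Ω ρ).toNNReal : ℝ≥0∞) ≠ 0 := by
      simpa using hC
    have hh2 : ENNReal.ofReal (h ^ 2) ≠ 0 := by simpa using hh.ne'
    have hh1 : ENNReal.ofReal h ≠ 0 := by simpa using hh
    rw [hM, ENNReal.mul_top (mul_ne_zero (mul_ne_zero hC' hvol) hh2),
      ENNReal.mul_top (mul_ne_zero (mul_ne_zero hC' hvol) hh1)]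
    exact ⟨le_top, le_top⟩
  set M := (thirdDerivNorm Ω u).toReal
  have hM0 : 0 ≤ M := ENNReal.toReal_nonneg
  have hMr : thirdDerivNorm Ω u = ENNReal.ofReal M := (ENNReal.ofReal_toReal hM).symm
  have hpb := piecewiseBound_interp hΩ hρ h𝒯 hdiam hnd hloc hcomp
    (c21Bound_of_contDiffOn hΩ hu hM)
  have hCr : ((interpConst Ω ρ).toNNReal : ℝ≥0∞) = ENNReal.ofReal (interpConst Ω ρ) := rfl
  have hrw : ∀ a : ℝ, 0 ≤ a → ENNReal.ofReal (interpConst Ω ρ) * volume Ω * ENNReal.ofReal a *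
      ENNReal.ofReal M = volume Ω * ENNReal.ofReal (interpConst Ω ρ * a * M) := by
    intro a ha
    rw [ENNReal.ofReal_mul (by positivity), ENNReal.ofReal_mul hC.le]
    ring
  have q1 : 0 ≤ 5000 * Metric.diam Ω ^ 3 := by positivity
  have q2 : 0 ≤ 80000 * Metric.diam Ω ^ 2 / ρ := by positivity
  have q3 : 0 ≤ 6400000 * Metric.diam Ω / ρ ^ 2 := by positivity
  rw [hCr, hMr, hrw _ (sq_nonneg h), hrw _ hh.le]
  constructor
  · refine (normW11_le hΩ h𝒯 (by positivity) hpb).trans ?_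
    rw [← mul_add, ← ENNReal.ofReal_add (by positivity) (by positivity)]
    gcongr
    calc _ = (5000 * Metric.diam Ω ^ 3 + 80000 * Metric.diam Ω ^ 2 / ρ) * h ^ 2 * M := by ring
      _ ≤ interpConst Ω ρ * h ^ 2 * M := by
          gcongr
          unfold interpConst
          linarith
  · refine (hessianVariation_le hΩ h𝒯 hpb).trans ?_
    refine mul_le_mul_right (ENNReal.ofReal_le_ofReal ?_) _
    calc _ = (6400000 * Metric.diam Ω / ρ ^ 2) * h * M := by ring
      _ ≤ interpConst Ω ρ * h * M := by
          gcongr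
          unfold interpConst
          linarith

end PlateFEM

end

/-! ### The estimates for both elements -/

theorem mainTheorem3 (Ω : Set PlateFEM.Plane) (hΩ : PlateFEM.IsConvexPolygonalDomain Ω)
    (ρ : ℝ) (hρ : 0 < ρ) :
    ∃ C : ℝ≥0, ∀ (𝒯 : ℕ → Finset PlateFEM.Tri) (h : ℕ → ℝ),
      PlateFEM.IsNondegenerateFamily Ω ρ 𝒯 h →
      ∀ u : PlateFEM.Plane → ℝ, ContDiffOn ℝ 3 u (closure Ω) →
      ∀ n : ℕ,
        (PlateFEM.normW11 Ω (fun x => u x - PlateFEM.lagrangeInterp (𝒯 n) u x) ≤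
            C * volume Ω * ENNReal.ofReal (h n ^ 2) * PlateFEM.thirdDerivNorm Ω u ∧
          PlateFEM.hessianVariation Ω (fun x => u x - PlateFEM.lagrangeInterp (𝒯 n) u x) ≤
            C * volume Ω * ENNReal.ofReal (h n) * PlateFEM.thirdDerivNorm Ω u) ∧
        (PlateFEM.normW11 Ω (fun x => u x - PlateFEM.hermiteInterp (𝒯 n) u x) ≤
            C * volume Ω * ENNReal.ofReal (h n ^ 2) * PlateFEM.thirdDerivNorm Ω u ∧
          PlateFEM.hessianVariation Ω (fun x => u x - PlateFEM.hermiteInterp (𝒯 n) u x) ≤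
            C * volume Ω * ENNReal.ofReal (h n) * PlateFEM.thirdDerivNorm Ω u) := by
  refine ⟨(PlateFEM.interpConst Ω ρ).toNNReal, fun 𝒯 h hF u hu n => ?_⟩
  have h𝒯 := hF.triangulation n
  exact ⟨PlateFEM.interp_estimate hΩ hρ h𝒯 (hF.diam_le n) (hF.nondegenerate n)
      PlateFEM.lagrange_localErrorBound hu (PlateFEM.lagrange_compatible h𝒯 u),
    PlateFEM.interp_estimate hΩ hρ h𝒯 (hF.diam_le n) (hF.nondegenerate n)
      PlateFEM.hermite_localErrorBound hu
      (PlateFEM.hermite_compatible h𝒯 (hu.differentiableOn (by norm_num)))⟩
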